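/- Let $\Theta$ and $\Xi$ be finite non-empty sets. A marked graph is a simple graph $G$ with a mark $\tau(v)\in\Theta$ at every vertex $v$ and, for every edge $\{v,w\}$, two marks $\xi(v,w),\xi(w,v)\in\Xi$, one for each orientation. Let $\bar{\mathcal G}_*$ be the space of connected, locally finite, rooted marked graphs up to isomorphisms preserving the root and the marks, with the local topology. For $r\in\mathbb N$, $[G,o]_r$ is the rooted marked subgraph induced by the vertices within distance $r$ of the root $o$, and for a probability measure $\mu$ on $\bar{\mathcal G}_*$, $\mu_r$ is its image under $[G,o]\mapsto[G,o]_r$. The map $\pi_g$ forgets the marks; a probability measure carried by unmarked depth-one rooted graphs is identified with the law of the degree of the root, a probability measure on $\mathbb Z_+$. For a finite marked graph $G$ with $n$ vertices, $U(G)=\frac1n\sum_v\delta_{[G(v),v]}$, where $G(v)$ is the connected component of $v$, and $U(\pi_g(G))$ is defined in the same way from the unmarked graph $\pi_g(G)$. A probability measure $\mu$ on $\bar{\mathcal G}_*$ is unimodular if $\int\sum_{v\in V(G)} f([G,o,v])\,d\mu([G,o])=\int\sum_{v\in V(G)} f([G,v,o])\,d\mu([G,o])$ for every non-negative measurable function $f$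 of (isomorphism classes of) connected locally finite marked graphs with two distinguished vertices. For every $n\ge1$ let $\vec\ell_n=(\ell_{n,1},\dots,\ell_{n,n})$ be a vector of non-negative integers such that there is at least one simple graph on $[n]$ with degree sequence $\vec\ell_n$. Assume that $\sup_{n,i}\ell_{n,i}<\infty$ and that $P_n=\frac1n\sum_{i=1}^n\delta_{\ell_{n,i}}$ converges weakly to a probability measure $P$ on $\mathbb Z_+$. Let $k>1$ be an integer, let $L\in\mathbb N$, and let $\rho$ be a unimodular probability measure on $\bar{\mathcal G}_*$ supported on trees all of whose vertices have degree at most $L$, with $\rho_1\circ\pi_g^{-1}=P$. Then there is a sequence of marked graphs $(\widetilde\Gamma_n)_{n\ge1}$, with $\widetilde\Gamma_n$ on the vertex set $[n]$, such that $U(\widetilde\Gamma_n)_k\to\rho_k$ weakly as $n\to\infty$ and, for every $n\ge1$, $U(\pi_g(\widetilde\Gamma_n))_1=P_n$; moreover $\deg_{\widetilde\Gamma_n}(i)=\ell_{n,i}$ for all $n\ge1$ and all $i\in[n]$. -/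

import Mathlib

open Filter Topology MeasureTheory
open scoped ENNReal

universe u v

/-- A (simple) graph on `V` with vertex marks in `Θ` and edge marks in `Ξ`.
Every edge carries two marks, one for each orientation. -/
structure MarkedGraph (V : Type) (Θ : Type u) (Ξ : Type v) where
  graph : SimpleGraph V
  vertexMark : V → Θ
  edgeMark : ∀ x y : V, graph.Adj x y → Ξ

namespace MarkedGraph

variable {V : Type} {Θ : Type u} {Ξ : Type v}

/-- The number of neighbours of a vertex. -/
noncomputable def degree (G : MarkedGraph V Θ Ξ) (x : V) : ℕ :=
  (G.graph.neighborSet x).ncard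

/-- The marked subgraph induced on a set of vertices. -/
def induce (G : MarkedGraph V Θ Ξ) (s : Set V) : MarkedGraph s Θ Ξ where
  graph := G.graph.induce s
  vertexMark x := G.vertexMark x
  edgeMark x y h := G.edgeMark x y h

/-- Forget the marks: an unmarked graph is a marked graph with one-point mark spaces. -/
def unmark (G : MarkedGraph V Θ Ξ) : MarkedGraph V Unit Unit where
  graph := G.graph
  vertexMark _ := ()
  edgeMark _ _ _ := ()

/-- Record the vertex `y` by an additional vertex mark, which is `true` exactly at `y`. -/
noncomputable def distinguish (G : MarkedGraph V Θ Ξ) (y : V) : MarkedGraph V (Θ × Bool) Ξ where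
  graph := G.graph
  vertexMark x := (G.vertexMark x, @decide (x = y) (Classical.propDecidable _))
  edgeMark := G.edgeMark

end MarkedGraph

/-- Connected, locally finite, rooted marked graphs (before passing to isomorphism classes).
Their vertex sets are automatically countable, so that vertex sets in `Type` suffice. -/
structure PreRooted (Θ : Type u) (Ξ : Type v) where
  V : Type
  G : MarkedGraph V Θ Ξ
  root : V
  connected : G.graph.Connected
  locallyFinite : ∀ x, (G.graph.neighborSet x).Finite

namespace PreRooted

variable {Θ : Type u} {Ξ : Type v}

/-- Existence of an isomorphism: a graph isomorphism preserving the root and all marks. -/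
def Iso (A B : PreRooted Θ Ξ) : Prop :=
  ∃ φ : A.G.graph ≃g B.G.graph, φ A.root = B.root ∧
    (∀ x, B.G.vertexMark (φ x) = A.G.vertexMark x) ∧
    ∀ x y (h : A.G.graph.Adj x y),
      B.G.edgeMark (φ x) (φ y) (φ.map_adj_iff.2 h) = A.G.edgeMark x y h

theorem Iso.refl (A : PreRooted Θ Ξ) : A.Iso A :=
  ⟨RelIso.refl _, rfl, fun _ => rfl, fun _ _ _ => rfl⟩

theorem edgeMark_congr {V : Type} (G : MarkedGraph V Θ Ξ) {x y x' y' : V} (hx : x = x')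
    (hy : y = y') (h : G.graph.Adj x y) (h' : G.graph.Adj x' y') :
    G.edgeMark x y h = G.edgeMark x' y' h' := by
  subst hx; subst hy; rfl

theorem Iso.symm {A B : PreRooted Θ Ξ} (h : A.Iso B) : B.Iso A := by
  obtain ⟨φ, h0, h1, h2⟩ := h
  refine ⟨φ.symm, ?_, ?_, ?_⟩
  · rw [← h0]; exact φ.symm_apply_apply _
  · intro x
    rw [← h1, φ.apply_symm_apply]
  · intro x y h
    rw [← h2]
    exact edgeMark_congr _ (φ.apply_symm_apply _) (φ.apply_symm_apply _) _ _

theorem Iso.trans {A B C : PreRooted Θ Ξ} (h : A.Iso B) (h' : B.Iso C) : A.Iso C := by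
  obtain ⟨φ, h0, h1, h2⟩ := h
  obtain ⟨ψ, k0, k1, k2⟩ := h'
  refine ⟨φ.trans ψ, ?_, ?_, ?_⟩
  · rw [← k0, ← h0]; rfl
  · intro x
    rw [← h1, ← k1]; rfl
  · intro x y h
    rw [← h2, ← k2]; rfl

instance setoid (Θ : Type u) (Ξ : Type v) : Setoid (PreRooted Θ Ξ) where
  r := Iso
  iseqv := ⟨Iso.refl, Iso.symm, Iso.trans⟩

/-- The vertices within distance `r` from the root. -/
def ball (A : PreRooted Θ Ξ) (r : ℕ) : Set A.V := {x | A.G.graph.dist A.root x ≤ r}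

theorem root_mem_ball (A : PreRooted Θ Ξ) (r : ℕ) : A.root ∈ A.ball r := by
  simp [ball]

theorem ball_connected (A : PreRooted Θ Ξ) (r : ℕ) :
    (A.G.graph.induce (A.ball r)).Connected := by
  rw [SimpleGraph.connected_iff_exists_forall_reachable]
  refine ⟨⟨A.root, A.root_mem_ball r⟩, ?_⟩
  rintro ⟨x, hx⟩
  obtain ⟨p, hp⟩ := A.connected.exists_walk_length_eq_dist A.root x
  have hs : ∀ y ∈ p.support, y ∈ A.ball r := by
    intro y hy
    classical
    have h1 := SimpleGraph.dist_le (p.takeUntil y hy)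
    have h2 := p.length_takeUntil_le_length hy
    have h3 : A.G.graph.dist A.root x ≤ r := hx
    show A.G.graph.dist A.root y ≤ r
    omega
  exact ⟨p.induce _ hs⟩

theorem finite_induce {V : Type} (G : SimpleGraph V) (s : Set V) (x : s)
    (h : (G.neighborSet x).Finite) : ((G.induce s).neighborSet x).Finite :=
  Set.Finite.of_finite_image (h.subset (by rintro _ ⟨y, hy, rfl⟩; exact hy))
    Subtype.val_injective.injOn

/-- Truncation at depth `r`: the marked subgraph induced by the vertices within distance `r`
from the root. -/
def trunc (r : ℕ) (A : PreRooted Θ Ξ) : PreRooted Θ Ξ where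
  V := A.ball r
  G := A.G.induce (A.ball r)
  root := ⟨A.root, A.root_mem_ball r⟩
  connected := A.ball_connected r
  locallyFinite x := finite_induce _ _ _ (A.locallyFinite x)

/-- Forget the marks. -/
def unmark (A : PreRooted Θ Ξ) : PreRooted Unit Unit where
  V := A.V
  G := A.G.unmark
  root := A.root
  connected := A.connected
  locallyFinite := A.locallyFinite

/-- The doubly rooted graph `(G, x, y)`, where `G` is the underlying marked graph of `A`:
the first root is the root, the second one is recorded by an additional vertex mark. -/
noncomputable def doublyRooted (A : PreRooted Θ Ξ) (x y : A.V) : PreRooted (Θ × Bool) Ξ where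
  V := A.V
  G := A.G.distinguish y
  root := x
  connected := A.connected
  locallyFinite := A.locallyFinite

theorem Iso.dist_eq {A B : PreRooted Θ Ξ} (φ : A.G.graph ≃g B.G.graph) (x y : A.V) :
    B.G.graph.dist (φ x) (φ y) = A.G.graph.dist x y := by
  apply le_antisymm
  · obtain ⟨p, hp⟩ := A.connected.exists_walk_length_eq_dist x y
    rw [← hp]
    simpa using SimpleGraph.dist_le (p.map φ.toHom)
  · obtain ⟨p, hp⟩ := B.connected.exists_walk_length_eq_dist (φ x) (φ y)
    rw [← hp]
    have h := SimpleGraph.dist_le (p.map φ.symm.toHom)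
    simpa using h

theorem Iso.trunc {A B : PreRooted Θ Ξ} (h : A.Iso B) (r : ℕ) :
    (A.trunc r).Iso (B.trunc r) := by
  obtain ⟨φ, h0, h1, h2⟩ := h
  have hm : ∀ x, x ∈ A.ball r ↔ φ x ∈ B.ball r := by
    intro x
    show _ ≤ r ↔ _ ≤ r
    rw [← h0, Iso.dist_eq]
  refine ⟨⟨φ.toEquiv.subtypeEquiv hm, ?_⟩, ?_, ?_, ?_⟩
  · intro x y
    exact φ.map_adj_iff
  · exact Subtype.ext h0
  · intro x
    exact h1 x.1
  · intro x y h
    exact h2 x.1 y.1 h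

theorem Iso.unmark {A B : PreRooted Θ Ξ} (h : A.Iso B) : A.unmark.Iso B.unmark := by
  obtain ⟨φ, h0, -, -⟩ := h
  exact ⟨φ, h0, fun _ => rfl, fun _ _ _ => rfl⟩

theorem Iso.doublyRooted {A B : PreRooted Θ Ξ} (φ : A.G.graph ≃g B.G.graph)
    (h1 : ∀ x, B.G.vertexMark (φ x) = A.G.vertexMark x)
    (h2 : ∀ x y (h : A.G.graph.Adj x y),
      B.G.edgeMark (φ x) (φ y) (φ.map_adj_iff.2 h) = A.G.edgeMark x y h) (x y : A.V) :
    (A.doublyRooted x y).Iso (B.doublyRooted (φ x) (φ y)) := by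
  refine ⟨φ, rfl, fun z => ?_, h2⟩
  refine Prod.ext (h1 z) ?_
  show @decide (φ z = φ y) (Classical.propDecidable _) = @decide (z = y) (Classical.propDecidable _)
  have h : (φ z = φ y) = (z = y) := propext φ.injective.eq_iff
  rw [h]

theorem Iso.degree_root {A B : PreRooted Θ Ξ} (h : A.Iso B) :
    A.G.degree A.root = B.G.degree B.root := by
  obtain ⟨φ, h0, -, -⟩ := h
  rw [← h0]
  exact Nat.card_congr (φ.mapNeighborSet A.root)

end PreRooted

/-- The space of connected, locally finite, rooted marked graphs up to isomorphism. -/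
def RootedGraphs (Θ : Type u) (Ξ : Type v) : Type (max 1 u v) :=
  Quotient (PreRooted.setoid Θ Ξ)

namespace RootedGraphs

variable {Θ : Type u} {Ξ : Type v}

/-- The isomorphism class of a rooted marked graph. -/
def mk (A : PreRooted Θ Ξ) : RootedGraphs Θ Ξ := Quotient.mk _ A

/-- Truncation at depth `r`. -/
def trunc (r : ℕ) : RootedGraphs Θ Ξ → RootedGraphs Θ Ξ :=
  Quotient.lift (fun A => mk (A.trunc r)) fun _ _ h => Quotient.sound (h.trunc r)

/-- The projection on unmarked rooted graphs. -/
def unmark : RootedGraphs Θ Ξ → RootedGraphs Unit Unit :=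
  Quotient.lift (fun A => mk A.unmark) fun _ _ h => Quotient.sound h.unmark

/-- The degree of the root. -/
noncomputable def rootDegree : RootedGraphs Θ Ξ → ℕ :=
  Quotient.lift (fun A => A.G.degree A.root) fun _ _ h => h.degree_root

/-- The local topology: two rooted graphs are close if their truncations at a large depth are
isomorphic. It is the coarsest topology for which every truncation is continuous with values in
the discrete space of isomorphism classes; as the mark spaces are finite, this is the topology
of the usual local metric. -/
instance : TopologicalSpace (RootedGraphs Θ Ξ) :=
  ⨅ r : ℕ, TopologicalSpace.induced (trunc r) ⊥

instance : MeasurableSpace (RootedGraphs Θ Ξ) := borel _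

instance : BorelSpace (RootedGraphs Θ Ξ) := ⟨rfl⟩

theorem continuous_comp_trunc {X : Type*} [TopologicalSpace X] (r : ℕ)
    (f : RootedGraphs Θ Ξ → X) : Continuous fun g : RootedGraphs Θ Ξ => f (trunc r g) := by
  rw [continuous_def]
  intro s _
  have h : IsOpen[TopologicalSpace.induced (trunc r) ⊥] (trunc r ⁻¹' (f ⁻¹' s)) :=
    ⟨f ⁻¹' s, @isOpen_discrete _ ⊥ (@DiscreteTopology.mk _ ⊥ rfl) _, rfl⟩
  exact iInf_le (fun r => TopologicalSpace.induced (trunc (Θ := Θ) (Ξ := Ξ) r) ⊥) r _ h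

/-- The law of the truncation at depth `k`. -/
noncomputable def truncLaw (k : ℕ) (μ : ProbabilityMeasure (RootedGraphs Θ Ξ)) :
    ProbabilityMeasure (RootedGraphs Θ Ξ) :=
  μ.map (continuous_comp_trunc k id).measurable.aemeasurable

/-- The law of the unmarked version of the truncation at depth one, as a probability measure on
the natural numbers: an unmarked depth-one tree, a star, is identified with the degree of its
root. -/
noncomputable def depthOneLaw (μ : ProbabilityMeasure (RootedGraphs Θ Ξ)) :
    ProbabilityMeasure ℕ :=
  μ.map (f := fun g => rootDegree (unmark (trunc 1 g)))
    (continuous_comp_trunc 1 fun g => rootDegree (unmark g)).measurable.aemeasurable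

/-- The rooted graph is a tree all of whose vertices have degree at most `L`. -/
def IsTreeWithDegreeLE (L : ℕ) (g : RootedGraphs Θ Ξ) : Prop :=
  ∃ A : PreRooted Θ Ξ, mk A = g ∧ A.G.graph.IsTree ∧ ∀ x, A.G.degree x ≤ L

/-- `[G, o] ↦ ∑ x, f [G, o, x]`, where `f` is a function of doubly rooted graphs. -/
noncomputable def massOut (f : RootedGraphs (Θ × Bool) Ξ → ℝ≥0∞) : RootedGraphs Θ Ξ → ℝ≥0∞ :=
  Quotient.lift (fun A => ∑' x : A.V, f (mk (A.doublyRooted A.root x))) (by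
    rintro A B ⟨φ, h0, h1, h2⟩
    show (∑' x : A.V, f (mk (A.doublyRooted A.root x))) =
      ∑' x : B.V, f (mk (B.doublyRooted B.root x))
    rw [← φ.toEquiv.tsum_eq, ← h0]
    exact tsum_congr fun x => congrArg f
      (Quotient.sound (PreRooted.Iso.doublyRooted φ h1 h2 A.root x)))

/-- `[G, o] ↦ ∑ x, f [G, x, o]`, where `f` is a function of doubly rooted graphs. -/
noncomputable def massIn (f : RootedGraphs (Θ × Bool) Ξ → ℝ≥0∞) : RootedGraphs Θ Ξ → ℝ≥0∞ :=
  Quotient.lift (fun A => ∑' x : A.V, f (mk (A.doublyRooted x A.root))) (by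
    rintro A B ⟨φ, h0, h1, h2⟩
    show (∑' x : A.V, f (mk (A.doublyRooted x A.root))) =
      ∑' x : B.V, f (mk (B.doublyRooted x B.root))
    rw [← φ.toEquiv.tsum_eq, ← h0]
    exact tsum_congr fun x => congrArg f
      (Quotient.sound (PreRooted.Iso.doublyRooted φ h1 h2 x A.root)))

/-- Unimodularity. A doubly rooted graph is a rooted graph in which the second root is recorded
by an additional vertex mark: isomorphisms preserving the root and the marks are exactly the
isomorphisms of marked graphs preserving both roots, and the local topologies agree. Values of
`f` at rooted graphs that do not have exactly one marked vertex play no role. -/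
def IsUnimodular (μ : ProbabilityMeasure (RootedGraphs Θ Ξ)) : Prop :=
  ∀ f : RootedGraphs (Θ × Bool) Ξ → ℝ≥0∞, Measurable f →
    ∫⁻ g, massOut f g ∂(μ : Measure (RootedGraphs Θ Ξ)) =
      ∫⁻ g, massIn f g ∂(μ : Measure (RootedGraphs Θ Ξ))

end RootedGraphs

/-- The empirical measure `(1 / |V|) ∑ x, δ_(a x)` of a finite non-empty family. -/
noncomputable def empiricalMeasure {V : Type} [Fintype V] [Nonempty V] {X : Type*}
    [MeasurableSpace X] (a : V → X) : ProbabilityMeasure X :=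
  ⟨(Fintype.card V : ℝ≥0∞)⁻¹ • ∑ x, Measure.dirac (a x), ⟨by
    simp only [Measure.smul_apply, Measure.coe_finsetSum, Finset.sum_apply, measure_univ,
      Finset.sum_const, Finset.card_univ, nsmul_eq_mul, mul_one, smul_eq_mul]
    exact ENNReal.inv_mul_cancel (by simp) (by simp)⟩⟩

namespace MarkedGraph

variable {V : Type} {Θ : Type u} {Ξ : Type v}

theorem component_connected (G : MarkedGraph V Θ Ξ) (x : V) :
    (G.graph.induce {y | G.graph.Reachable x y}).Connected := by
  rw [SimpleGraph.connected_iff_exists_forall_reachable]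
  refine ⟨⟨x, SimpleGraph.Reachable.refl x⟩, ?_⟩
  rintro ⟨y, ⟨p⟩⟩
  classical
  have hs : ∀ z ∈ p.support, z ∈ {y | G.graph.Reachable x y} := fun z hz => ⟨p.takeUntil z hz⟩
  exact ⟨p.induce _ hs⟩

/-- The connected component of `x`, rooted at `x`. -/
def component [Finite V] (G : MarkedGraph V Θ Ξ) (x : V) : PreRooted Θ Ξ where
  V := {y | G.graph.Reachable x y}
  G := G.induce {y | G.graph.Reachable x y}
  root := ⟨x, SimpleGraph.Reachable.refl x⟩
  connected := G.component_connected x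
  locallyFinite _ := Set.toFinite _

/-- The empirical neighbourhood distribution of a finite marked graph. -/
noncomputable def neighbourhoodDistribution [Fintype V] [Nonempty V] (G : MarkedGraph V Θ Ξ) :
    ProbabilityMeasure (RootedGraphs Θ Ξ) :=
  empiricalMeasure fun x => RootedGraphs.mk (G.component x)

end MarkedGraph

/-!
The graphs are constructed deterministically, by a greedy matching of half-edges followed by a
repair of the degrees.

**Colours.** Colour refinement attaches to each vertex of a marked graph a colour from a finite set
(`Code`): the initial colour is the vertex mark, and each round records the numbers of neighbours
with given edge marks and given previous colour. If the balls of radius `k` around two roots are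
trees, then they are isomorphic as soon as the roots have the same colour after `k` rounds
(`PreRooted.trunc_iso_of_code_eq`). Hence the law `ρ_k` is encoded by the law `q` of the colour of
the root, and it is enough to find graphs on `[n]` in which, up to `o(n)` vertices, the ball of
radius `k` is a tree and the colours have distribution `q`.

**Matching.** Distribute the colours among the vertices according to `q`, compatibly with the
degrees `ℓ n i` (`exists_assignment`; here the law of the degree under `ρ` has to be the limit `P`).
A colour prescribes the half-edges at its vertex: how many neighbours of which colour in round
`k - 1`, along edges with which marks. Half-edges of opposite kinds are matched one after the other,
as long as this does not create a short cycle. When this is no longer possible, all unmatched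
half-edges of a kind and of the opposite kind are close to each other, so that, degrees being
bounded, either a bounded number of them is left or one of the two kinds is used up
(`MarkedGraph.exists_matching`). Unimodularity says precisely that opposite kinds occur equally
often in the mean (`RootedGraphs.IsUnimodular.sum_code_eq`), so that `o(n)` half-edges remain
unmatched. A vertex near which all vertices are completely matched has the prescribed
colour (`MarkedGraph.code_eq_of_forall_nbrCount`).

**Degrees.** The resulting graph has degrees at most `ℓ n i`, with total deficiency `o(n)`. Removing
an edge `ab` and adding edges `ua` and `vb` repairs the deficiency of `u` and `v` and changes the
neighbourhoods of at most four vertices; the total deficiency is even since `ℓ n` is graphical. If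
almost all vertices are isolated there is no room for such switches, but then any realization of
`ℓ n` differs from the matching at few vertices only (`SimpleGraph.exists_degrees_of_le`). Since the
degrees are bounded, altering `o(n)` vertices spoils the balls of only `o(n)` vertices.
-/

/-! ### Finite sets -/

theorem Set.ncard_biUnion_le_mul {α β : Type*} [Finite α] [Finite β] (s : Set α) (f : α → Set β)
    (M : ℕ) (h : ∀ a ∈ s, (f a).ncard ≤ M) : (⋃ a ∈ s, f a).ncard ≤ s.ncard * M := by
  classical
  have := Fintype.ofFinite α
  have := Fintype.ofFinite β
  have h1 : (⋃ a ∈ s, f a) = ↑(s.toFinset.biUnion fun a => (f a).toFinset) := by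
    ext x; simp
  rw [h1, Set.ncard_coe_finset, Set.ncard_eq_toFinset_card' s]
  refine Finset.card_biUnion_le_card_mul _ _ _ fun a ha => ?_
  rw [← Set.ncard_eq_toFinset_card']
  exact h a (by simpa using ha)

namespace SimpleGraph

variable {V : Type}

/-! ### Prescribing the degrees of a graph by switching edges -/

theorem sup_edge_adj_iff {G : SimpleGraph V} {x y : V} (hxy : x ≠ y) (z w : V) :
    (G ⊔ edge x y).Adj z w ↔ G.Adj z w ∨ (z = x ∧ w = y) ∨ (z = y ∧ w = x) := by
  rw [sup_adj, edge_adj]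
  constructor
  · rintro (h | ⟨h, -⟩)
    · exact Or.inl h
    · exact Or.inr h
  · rintro (h | ⟨rfl, rfl⟩ | ⟨rfl, rfl⟩)
    · exact Or.inl h
    · exact Or.inr ⟨Or.inl ⟨rfl, rfl⟩, hxy⟩
    · exact Or.inr ⟨Or.inr ⟨rfl, rfl⟩, hxy.symm⟩

open Classical in
theorem ncard_neighborSet_sup_edge [Finite V] {G : SimpleGraph V} {x y : V} (hxy : x ≠ y)
    (h : ¬ G.Adj x y) (z : V) :
    ((G ⊔ edge x y).neighborSet z).ncard =
      (G.neighborSet z).ncard + (if z = x then 1 else 0) + (if z = y then 1 else 0) := by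
  by_cases hx : z = x
  · subst hx
    have h1 : (G ⊔ edge z y).neighborSet z = insert y (G.neighborSet z) := by
      ext w
      simp only [mem_neighborSet, sup_edge_adj_iff hxy, Set.mem_insert_iff]
      grind
    rw [h1, Set.ncard_insert_of_notMem (by simpa using h) (Set.toFinite _)]
    simp [hxy]
  · by_cases hy : z = y
    · subst hy
      have h1 : (G ⊔ edge x z).neighborSet z = insert x (G.neighborSet z) := by
        ext w
        simp only [mem_neighborSet, sup_edge_adj_iff hxy, Set.mem_insert_iff]
        grind
      rw [h1, Set.ncard_insert_of_notMem (by simpa [G.adj_comm] using h) (Set.toFinite _)]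
      simp [hx]
    · have h1 : (G ⊔ edge x y).neighborSet z = G.neighborSet z := by
        ext w
        simp only [mem_neighborSet, sup_edge_adj_iff hxy]
        grind
      rw [h1]; simp [hx, hy]

theorem even_sum_ncard_neighborSet [Fintype V] (G : SimpleGraph V) :
    Even (∑ v, (G.neighborSet v).ncard) := by
  classical
  have h : ∀ v, (G.neighborSet v).ncard = G.degree v := fun v => by
    rw [Set.ncard_eq_toFinset_card', ← card_neighborSet_eq_degree, Set.toFinset_card]
  simp_rw [h, sum_degrees_eq_twice_card_edges]
  exact even_two_mul _

open Classical in
/-- The switching move: the edge `ab` is replaced by the edges `ua` and `vb`. It changes only the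
degrees of `u` and `v`, which go up by one (by two if `u = v`). -/
theorem exists_switch [Finite V] (H : SimpleGraph V) {u v a b : V} (hab : H.Adj a b) (hau : a ≠ u)
    (hbu : b ≠ u) (hbv : b ≠ v) (hua : ¬ H.Adj u a) (hvb : ¬ H.Adj v b) :
    ∃ H' : SimpleGraph V,
      (∀ z, (H'.neighborSet z).ncard =
        (H.neighborSet z).ncard + (if z = u then 1 else 0) + (if z = v then 1 else 0)) ∧
      {z | H'.neighborSet z ≠ H.neighborSet z} ⊆ {u, v, a, b} := by
  have hne : a ≠ b := hab.ne
  set H0 := H.deleteEdges {s(a, b)} with hH0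
  have h0 : ∀ z w, H0.Adj z w ↔ H.Adj z w ∧ ¬ ((z = a ∧ w = b) ∨ (z = b ∧ w = a)) := by
    intro z w
    rw [hH0, deleteEdges_adj]
    simp
  have hback : H = H0 ⊔ edge a b := by
    ext z w
    rw [sup_edge_adj_iff hne, h0]
    have := hab.symm
    grind
  have d0 := ncard_neighborSet_sup_edge (G := H0) hne (by rw [h0]; simp)
  rw [← hback] at d0
  have d1 := ncard_neighborSet_sup_edge (G := H0) hau.symm (by rw [h0]; tauto)
  have d2 := ncard_neighborSet_sup_edge (G := H0 ⊔ edge u a) hbv.symm (by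
    rw [sup_edge_adj_iff hau.symm, h0]; grind)
  refine ⟨H0 ⊔ edge u a ⊔ edge v b, fun z => ?_, fun z hz => ?_⟩
  · rw [d2, d1, d0]; ring
  · by_contra hz'
    simp only [Set.mem_insert_iff, Set.mem_singleton_iff, not_or] at hz'
    apply hz
    ext w
    simp only [mem_neighborSet]
    rw [sup_edge_adj_iff hbv.symm, sup_edge_adj_iff hau.symm, h0]
    grind

/-- If many vertices are not isolated, then there is an edge both of whose endpoints avoid
two given vertices and their neighbours. -/
theorem exists_adj_far [Finite V] {H : SimpleGraph V} {M : ℕ}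
    (hM : ∀ z, (H.neighborSet z).ncard ≤ M) (u v : V) (hK : (2 * M + 2) * (M + 1) < {z | 0 < (H.neighborSet z).ncard}.ncard) :
    ∃ a b, H.Adj a b ∧ (a ≠ u ∧ a ≠ v ∧ ¬ H.Adj u a ∧ ¬ H.Adj v a) ∧
      (b ≠ u ∧ b ≠ v ∧ ¬ H.Adj u b ∧ ¬ H.Adj v b) := by
  set A : Set V := {u, v} ∪ (H.neighborSet u ∪ H.neighborSet v) with hA
  have hAc : A.ncard ≤ 2 * M + 2 := by
    have h1 := Set.ncard_union_le {u, v} (H.neighborSet u ∪ H.neighborSet v)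
    have h2 := Set.ncard_union_le (H.neighborSet u) (H.neighborSet v)
    have h3 := Set.ncard_insert_le u {v}
    have h4 := hM u
    have h5 := hM v
    rw [Set.ncard_singleton] at h3
    rw [hA]
    omega
  have hmem : ∀ a, a ∉ A → a ≠ u ∧ a ≠ v ∧ ¬ H.Adj u a ∧ ¬ H.Adj v a := by
    intro a ha
    simpa [hA, not_or, and_assoc] using ha
  by_contra hcon
  have hsub : {z | 0 < (H.neighborSet z).ncard} ⊆ ⋃ a ∈ A, insert a (H.neighborSet a) := by
    intro z hz
    rw [Set.mem_iUnion₂]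
    by_cases hzA : z ∈ A
    · exact ⟨z, hzA, Set.mem_insert _ _⟩
    · obtain ⟨w, hw⟩ := Set.nonempty_of_ncard_ne_zero (Nat.pos_iff_ne_zero.1 hz)
      have hw' : H.Adj z w := hw
      refine ⟨w, ?_, Set.mem_insert_of_mem _ hw'.symm⟩
      by_contra hwA
      exact hcon ⟨z, w, hw', hmem z hzA, hmem w hwA⟩
  have h1 := Set.ncard_le_ncard hsub (Set.toFinite _)
  have h2 := Set.ncard_biUnion_le_mul A (fun a => insert a (H.neighborSet a)) (M + 1)
    fun a _ => (Set.ncard_insert_le _ _).trans (Nat.succ_le_succ (hM a))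
  have h3 := Nat.mul_le_mul_right (M + 1) hAc
  omega

/-- If many vertices are not isolated, then the degrees of `H` can be raised to a prescribed
sequence with even sum by repeated switching; degrees never decrease in the process. -/
theorem exists_degrees_of_many_nonisolated [Fintype V] (ℓ : V → ℕ) (M : ℕ) (hℓ : ∀ z, ℓ z ≤ M)
    (heven : Even (∑ z, ℓ z)) (D : ℕ) :
    ∀ H : SimpleGraph V, (∀ z, (H.neighborSet z).ncard ≤ ℓ z) →
      (∑ z, (H.neighborSet z).ncard) + D = ∑ z, ℓ z →
      (2 * M + 2) * (M + 1) < {z | 0 < (H.neighborSet z).ncard}.ncard →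
      ∃ G : SimpleGraph V, (∀ z, (G.neighborSet z).ncard = ℓ z) ∧
        {z | G.neighborSet z ≠ H.neighborSet z}.ncard ≤ 2 * D := by
  classical
  induction D using Nat.strong_induction_on with
  | _ D ih =>
  intro H hH hD hK
  by_cases hall : ∀ z, (H.neighborSet z).ncard = ℓ z
  · exact ⟨H, hall, by simp⟩
  push Not at hall
  obtain ⟨u, hu⟩ := hall
  have hu : (H.neighborSet u).ncard < ℓ u := lt_of_le_of_ne (hH u) hu
  -- a second missing half-edge exists since the total number of missing half-edges is even
  obtain ⟨v, hv⟩ : ∃ v, ∀ z, (H.neighborSet z).ncard + (if z = u then 1 else 0) +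
      (if z = v then 1 else 0) ≤ ℓ z := by
    by_cases h1 : ∃ v, v ≠ u ∧ (H.neighborSet v).ncard < ℓ v
    · obtain ⟨v, hvu, hv⟩ := h1
      refine ⟨v, fun z => ?_⟩
      have := hH z
      split_ifs with h2 h3 h3
      · exact absurd (h3.symm.trans h2) hvu
      · subst h2; omega
      · subst h3; omega
      · omega
    · push Not at h1
      refine ⟨u, fun z => ?_⟩
      by_cases hzu : z = u
      · subst hzu
        by_contra hlt
        have h2 : ∀ w, ℓ w = (H.neighborSet w).ncard + (if w = z then 1 else 0) := by
          intro w
          by_cases hw : w = z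
          · subst hw
            simp only [if_true] at hlt ⊢
            omega
          · have := h1 w hw
            have := hH w
            simp only [hw, if_false]
            omega
        have h3 : ∑ w, ℓ w = ∑ w, (H.neighborSet w).ncard + 1 := by
          rw [Finset.sum_congr rfl fun w _ => h2 w, Finset.sum_add_distrib]
          simp
        have h4 := even_sum_ncard_neighborSet H
        rw [h3] at heven
        exact (Nat.not_even_iff_odd.2 h4.add_one) heven
      · simpa [hzu] using hH z
  obtain ⟨a, b, hab, ⟨ha1, -, ha3, -⟩, ⟨hb1, hb2, -, hb4⟩⟩ :=
    exists_adj_far (fun z => (hH z).trans (hℓ z)) u v hK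
  obtain ⟨H', hdeg, hch⟩ := exists_switch H hab ha1 hb1 hb2 ha3 hb4
  have hsum : ∑ z, (H'.neighborSet z).ncard = ∑ z, (H.neighborSet z).ncard + 2 := by
    rw [Finset.sum_congr rfl fun w _ => hdeg w, Finset.sum_add_distrib, Finset.sum_add_distrib]
    simp
  have hle : ∀ z, (H'.neighborSet z).ncard ≤ ℓ z := fun z => (hdeg z).trans_le (hv z)
  have hle2 := Finset.sum_le_sum fun z (_ : z ∈ Finset.univ) => hle z
  obtain ⟨G, hG, hGch⟩ := ih (D - 2) (by omega) H' hle (by omega)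
    (hK.trans_le (Set.ncard_le_ncard (fun z hz => by
      rw [Set.mem_ofPred_eq] at hz ⊢
      rw [hdeg]; omega) (Set.toFinite _)))
  refine ⟨G, hG, ?_⟩
  have hsub : {z | G.neighborSet z ≠ H.neighborSet z} ⊆
      {z | G.neighborSet z ≠ H'.neighborSet z} ∪ {u, v, a, b} := by
    intro z hz
    by_cases h : G.neighborSet z = H'.neighborSet z
    · refine Or.inr (hch ?_)
      intro h'
      exact hz (h.trans h')
    · exact Or.inl h
  have h1 := Set.ncard_le_ncard hsub (Set.toFinite _)
  have h2 := Set.ncard_union_le {z | G.neighborSet z ≠ H'.neighborSet z} {u, v, a, b}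
  have h3 : ({u, v, a, b} : Set V).ncard ≤ 4 := by
    have h1 := Set.ncard_insert_le u {v, a, b}
    have h2 := Set.ncard_insert_le v {a, b}
    have h3 := Set.ncard_insert_le a {b}
    rw [Set.ncard_singleton] at h3
    omega
  omega

/-- A graph whose degrees are at most those of a graphical sequence `ℓ` can be modified into one
with degree sequence `ℓ`, at a cost controlled by the total deficiency. If there is no room
for switching, then almost all vertices are isolated and any realization of `ℓ` will do. -/
theorem exists_degrees_of_le [Fintype V] (ℓ : V → ℕ) (M : ℕ) (hℓ : ∀ z, ℓ z ≤ M)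
    (G₀ : SimpleGraph V) (hG₀ : ∀ z, (G₀.neighborSet z).ncard = ℓ z)
    (H : SimpleGraph V) (hH : ∀ z, (H.neighborSet z).ncard ≤ ℓ z) :
    ∃ G : SimpleGraph V, (∀ z, (G.neighborSet z).ncard = ℓ z) ∧
      {z | G.neighborSet z ≠ H.neighborSet z}.ncard ≤
        2 * ∑ z, (ℓ z - (H.neighborSet z).ncard) + (2 * M + 2) * (M + 1) := by
  classical
  have hD : (∑ z, (H.neighborSet z).ncard) + ∑ z, (ℓ z - (H.neighborSet z).ncard) = ∑ z, ℓ z := by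
    rw [← Finset.sum_add_distrib]
    exact Finset.sum_congr rfl fun z _ => Nat.add_sub_cancel' (hH z)
  by_cases hK : (2 * M + 2) * (M + 1) < {z | 0 < (H.neighborSet z).ncard}.ncard
  · obtain ⟨G, h1, h2⟩ := exists_degrees_of_many_nonisolated ℓ M hℓ
      (by simpa only [hG₀] using even_sum_ncard_neighborSet G₀) _ H hH hD hK
    exact ⟨G, h1, by omega⟩
  · refine ⟨G₀, hG₀, ?_⟩
    have hsub : {z | G₀.neighborSet z ≠ H.neighborSet z} ⊆
        {z | 0 < (H.neighborSet z).ncard} ∪ {z | 0 < ℓ z - (H.neighborSet z).ncard} := by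
      intro z hz
      by_contra h
      simp only [Set.mem_union, Set.mem_ofPred_eq, not_or, not_lt, Nat.le_zero] at h
      apply hz
      have h1 : (G₀.neighborSet z).ncard = 0 := by rw [hG₀]; omega
      rw [Set.ncard_eq_zero (Set.toFinite _)] at h1
      rw [h1, ((Set.ncard_eq_zero (Set.toFinite _)).1 h.1)]
    have h1 := Set.ncard_le_ncard hsub (Set.toFinite _)
    have h2 := Set.ncard_union_le {z | 0 < (H.neighborSet z).ncard}
      {z | 0 < ℓ z - (H.neighborSet z).ncard}
    have h3 : {z | 0 < ℓ z - (H.neighborSet z).ncard}.ncard ≤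
        ∑ z, (ℓ z - (H.neighborSet z).ncard) := by
      rw [Set.ncard_eq_toFinset_card', Finset.card_eq_sum_ones]
      refine (Finset.sum_le_sum fun z hz => ?_).trans
        (Finset.sum_le_sum_of_subset (Finset.subset_univ _))
      simp only [Set.mem_toFinset, Set.mem_ofPred_eq] at hz
      exact hz
    omega

/-! ### Balls and short cycles -/

theorem Walk.exists_eq_concat {G : SimpleGraph V} {x y : V} (p : G.Walk x y)
    (hp : 0 < p.length) : ∃ (z : V) (q : G.Walk x z) (h : G.Adj z y), p = q.concat h := by
  cases p with
  | nil => simp at hp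
  | cons h1 p1 =>
    obtain ⟨z, q, h', hq⟩ := Walk.exists_cons_eq_concat h1 p1
    exact ⟨z, q, h', hq⟩

theorem ncard_walk_length_le [Finite V] {G : SimpleGraph V} {M : ℕ}
    (hM : ∀ z, (G.neighborSet z).ncard ≤ M) (x : V) (R : ℕ) :
    {y | ∃ p : G.Walk x y, p.length ≤ R}.ncard ≤ (M + 1) ^ R := by
  induction R with
  | zero =>
    have h : {y | ∃ p : G.Walk x y, p.length ≤ 0} ⊆ {x} := by
      rintro y ⟨p, hp⟩
      exact (Walk.eq_of_length_eq_zero (Nat.le_zero.1 hp)).symm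
    exact (Set.ncard_le_ncard h (Set.toFinite _)).trans (by simp)
  | succ R ih =>
    have hsub : {y | ∃ p : G.Walk x y, p.length ≤ R + 1} ⊆
        ⋃ a ∈ {y | ∃ p : G.Walk x y, p.length ≤ R}, insert a (G.neighborSet a) := by
      rintro y ⟨p, hp⟩
      rw [Set.mem_iUnion₂]
      rcases Nat.lt_or_ge R p.length with h | h
      · obtain ⟨z, q, h', rfl⟩ := p.exists_eq_concat (Nat.zero_lt_of_lt h)
        rw [Walk.length_concat] at hp
        exact ⟨z, ⟨q, by omega⟩, Set.mem_insert_of_mem _ h'⟩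
      · exact ⟨y, ⟨p, h⟩, Set.mem_insert _ _⟩
    refine (Set.ncard_le_ncard hsub (Set.toFinite _)).trans ?_
    refine (Set.ncard_biUnion_le_mul _ _ (M + 1) fun a _ =>
      (Set.ncard_insert_le _ _).trans (Nat.succ_le_succ (hM a))).trans ?_
    rw [pow_succ]
    exact Nat.mul_le_mul_right _ ih

/-- There are no cycles of length at most `R`: every subgraph with at most `R` edges is a
forest. -/
def NoShortCycle (R : ℕ) (G : SimpleGraph V) : Prop :=
  ∀ K ≤ G, K.edgeSet.ncard ≤ R → K.IsAcyclic

theorem noShortCycle_bot (R : ℕ) : NoShortCycle R (⊥ : SimpleGraph V) := by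
  intro K hK _
  rw [le_bot_iff.1 hK]
  exact isAcyclic_bot

/-- Joining two vertices at distance more than `R` creates no cycle of length at most `R`. -/
theorem NoShortCycle.sup_edge [Finite V] {G : SimpleGraph V} {R : ℕ} (hG : G.NoShortCycle R)
    {x y : V} (hxy : ∀ p : G.Walk x y, R < p.length) : (G ⊔ edge x y).NoShortCycle R := by
  intro K hK hR
  classical
  have := Fintype.ofFinite V
  set K0 := K.deleteEdges {s(x, y)} with hK0
  have hle : K0 ≤ G := by
    intro a b hab
    rw [hK0, deleteEdges_adj] at hab
    have h1 := hK hab.1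
    rw [sup_adj, edge_adj] at h1
    rcases h1 with h1 | ⟨h1, -⟩
    · exact h1
    · exact absurd (by simpa [Sym2.eq_iff] using h1) hab.2
  have hR0 : K0.edgeSet.ncard ≤ R :=
    (Set.ncard_le_ncard (edgeSet_mono (deleteEdges_le _)) (Set.toFinite _)).trans hR
  have hac := hG K0 hle hR0
  have hnr : ¬ K0.Reachable x y := by
    rintro ⟨p⟩
    have h1 := p.bypass_isPath.isTrail.length_le_card_edgeFinset
    have h2 := hxy (p.bypass.mapLe hle)
    rw [Walk.length_map] at h2
    rw [Set.ncard_eq_toFinset_card'] at hR0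
    have h3 : K0.edgeFinset = K0.edgeSet.toFinset := rfl
    rw [h3] at h1
    omega
  have h4 : K ≤ K0 ⊔ edge x y := by
    intro a b hab
    rw [sup_adj, edge_adj, hK0, deleteEdges_adj]
    by_cases h : s(a, b) = s(x, y)
    · refine Or.inr ⟨by simpa [Sym2.eq_iff] using h, hab.ne⟩
    · exact Or.inl ⟨hab, h⟩
  exact (hac.sup_edge_of_not_reachable hnr).anti h4

/-- Two short paths with the same endpoints agree in the absence of short cycles. They only
have to lie in a graph without short cycles. -/
theorem Walk.IsPath.eq_of_noShortCycle [Finite V] {G H : SimpleGraph V} {R k : ℕ}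
    (hH : H.NoShortCycle R) (hR : 2 * k ≤ R) {x y : V} {p q : G.Walk x y}
    (hp : p.IsPath) (hq : q.IsPath) (hpk : p.length ≤ k) (hqk : q.length ≤ k)
    (hpH : ∀ e ∈ p.edges, e ∈ H.edgeSet) (hqH : ∀ e ∈ q.edges, e ∈ H.edgeSet) : p = q := by
  classical
  set K : SimpleGraph V := fromEdgeSet {e | e ∈ p.edges ∨ e ∈ q.edges} with hK
  have hmem : ∀ e, (e ∈ p.edges ∨ e ∈ q.edges) → e ∈ K.edgeSet := by
    intro e he
    rw [hK, edgeSet_fromEdgeSet]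
    refine ⟨he, ?_⟩
    rcases he with he | he
    · exact G.not_isDiag_of_mem_edgeSet (p.edges_subset_edgeSet he)
    · exact G.not_isDiag_of_mem_edgeSet (q.edges_subset_edgeSet he)
  have hKH : K ≤ H := by
    rw [← edgeSet_subset_edgeSet]
    intro e he
    rw [hK, edgeSet_fromEdgeSet] at he
    exact he.1.elim (hpH e) (hqH e)
  have hcard : K.edgeSet.ncard ≤ R := by
    have h1 : K.edgeSet ⊆ ↑(p.edges.toFinset ∪ q.edges.toFinset) := by
      intro e he
      rw [hK, edgeSet_fromEdgeSet] at he
      simpa using he.1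
    have h2 := Set.ncard_le_ncard h1 (Finset.finite_toSet _)
    rw [Set.ncard_coe_finset] at h2
    have h3 := Finset.card_union_le p.edges.toFinset q.edges.toFinset
    have h4 := p.edges.toFinset_card_le
    have h5 := q.edges.toFinset_card_le
    rw [Walk.length_edges] at h4 h5
    omega
  have hac := hH K hKH hcard
  have h := (hac.subsingleton_path x y).elim ⟨_, hp.transfer fun e he => hmem e (Or.inl he)⟩
    ⟨_, hq.transfer fun e he => hmem e (Or.inr he)⟩
  have h' := congrArg (fun r : K.Path x y => (r : K.Walk x y).support) h
  simp only [Walk.support_transfer] at h'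
  exact Walk.ext_support h'

end SimpleGraph

/-! ### Colour refinement -/

theorem exists_equiv_of_card_fiber_eq {α β γ : Type*} [Finite α] [Finite β] (f : α → γ) (g : β → γ)
    (h : ∀ c, Nat.card {a // f a = c} = Nat.card {b // g b = c}) :
    ∃ e : α ≃ β, ∀ a, g (e a) = f a := by
  have e : ∀ c, {a // f a = c} ≃ {b // g b = c} := fun c => Classical.choice
    (Finite.card_eq.1 (h c))
  refine ⟨(Equiv.sigmaFiberEquiv f).symm.trans
    ((Equiv.sigmaCongrRight e).trans (Equiv.sigmaFiberEquiv g)), fun a => ?_⟩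
  exact (e (f a) ⟨a, rfl⟩).2

theorem sum_card_fiber {α γ : Type*} [Finite α] [Fintype γ] (f : α → γ) :
    ∑ c, Nat.card {a // f a = c} = Nat.card α := by
  rw [← Nat.card_sigma]
  exact Nat.card_congr (Equiv.sigmaFiberEquiv f)

/-- The colours of the vertices after `j` rounds of colour refinement. The colour at stage `j + 1`
records the colour at stage `j` and, for each triple consisting of two edge marks and a colour at
stage `j`, the number of neighbours of this kind. These numbers are capped at `W`, so that there
are finitely many colours. -/
def Code (Θ : Type u) (Ξ : Type v) (W : ℕ) : ℕ → Type (max u v)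
  | 0 => ULift.{v} Θ
  | j + 1 => Code Θ Ξ W j × (Ξ × Ξ × Code Θ Ξ W j → Fin (W + 1))

instance Code.finite (Θ : Type u) (Ξ : Type v) (W : ℕ) [Finite Θ] [Finite Ξ] :
    ∀ j, Finite (Code Θ Ξ W j)
  | 0 => inferInstanceAs (Finite (ULift Θ))
  | j + 1 => by
    have := Code.finite Θ Ξ W j
    exact inferInstanceAs (Finite (Code Θ Ξ W j × (Ξ × Ξ × Code Θ Ξ W j → Fin (W + 1))))

/-- The vertex mark recorded by a colour. -/
def Code.mark {Θ : Type u} {Ξ : Type v} {W : ℕ} : ∀ {j}, Code Θ Ξ W j → Θ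
  | 0, c => ULift.down c
  | _ + 1, c => Code.mark c.1

namespace MarkedGraph

variable {V V' : Type} {Θ : Type u} {Ξ : Type v} {B : Type*}

/-- The kind of the neighbour `y` of `x`: the marks of the edge and the colour of `y`. -/
def nbrType (G : MarkedGraph V Θ Ξ) (κ : V → B) (x : V) (y : G.graph.neighborSet x) : Ξ × Ξ × B :=
  (G.edgeMark x y y.2, G.edgeMark y x (G.graph.adj_symm y.2), κ y)

/-- The number of neighbours of `x` of a given kind. -/
noncomputable def nbrCount (G : MarkedGraph V Θ Ξ) (κ : V → B) (x : V) (c : Ξ × Ξ × B) : ℕ :=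
  Nat.card {y // G.nbrType κ x y = c}

/-- The colour of a vertex after `j` rounds of colour refinement. -/
noncomputable def code (G : MarkedGraph V Θ Ξ) (W : ℕ) : ∀ j, V → Code Θ Ξ W j
  | 0, x => ULift.up (G.vertexMark x)
  | j + 1, x => (G.code W j x, fun c =>
      ⟨min W (G.nbrCount (G.code W j) x c), Nat.lt_succ_of_le (min_le_left _ _)⟩)

theorem mark_code (G : MarkedGraph V Θ Ξ) (W j : ℕ) (x : V) :
    (G.code W j x).mark = G.vertexMark x := by
  induction j with
  | zero => rfl
  | succ j ih => exact ih

theorem nbrCount_le_degree (G : MarkedGraph V Θ Ξ) (κ : V → B) (x : V)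
    (hx : (G.graph.neighborSet x).Finite) (c : Ξ × Ξ × B) : G.nbrCount κ x c ≤ G.degree x := by
  have := hx.to_subtype
  rw [degree, ← Nat.card_coe_set_eq]
  exact Nat.card_le_card_of_injective Subtype.val Subtype.val_injective

theorem sum_nbrCount [Fintype B] [Fintype Ξ] (G : MarkedGraph V Θ Ξ) (κ : V → B) (x : V)
    (hx : (G.graph.neighborSet x).Finite) : ∑ c, G.nbrCount κ x c = G.degree x := by
  have := hx.to_subtype
  rw [degree, ← Nat.card_coe_set_eq]
  exact sum_card_fiber _

theorem code_succ_snd (G : MarkedGraph V Θ Ξ) (W j : ℕ) (x : V)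
    (hx : (G.graph.neighborSet x).Finite) (hW : G.degree x ≤ W) (c) :
    (((G.code W (j + 1) x).2 c : Fin (W + 1)) : ℕ) = G.nbrCount (G.code W j) x c :=
  min_eq_right ((G.nbrCount_le_degree _ x hx c).trans hW)

theorem nbrCount_congr {G : MarkedGraph V Θ Ξ} {G' : MarkedGraph V' Θ Ξ} {κ : V → B} {κ' : V' → B}
    {x : V} {x' : V'} (e : G.graph.neighborSet x ≃ G'.graph.neighborSet x')
    (he : ∀ y, G'.nbrType κ' x' (e y) = G.nbrType κ x y) :
    G'.nbrCount κ' x' = G.nbrCount κ x := by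
  funext c
  refine Nat.card_congr (e.subtypeEquiv fun y => ?_).symm
  rw [he]

theorem code_succ_congr {G : MarkedGraph V Θ Ξ} {G' : MarkedGraph V' Θ Ξ} {W j : ℕ}
    {x : V} {x' : V'} (h : G'.code W j x' = G.code W j x)
    (e : G.graph.neighborSet x ≃ G'.graph.neighborSet x')
    (he : ∀ y, G'.nbrType (G'.code W j) x' (e y) = G.nbrType (G.code W j) x y) :
    G'.code W (j + 1) x' = G.code W (j + 1) x := by
  exact Prod.ext h (funext fun c => Fin.ext (congrArg (min W) (congrFun (nbrCount_congr e he) c)))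

theorem code_eq_of_succ {G : MarkedGraph V Θ Ξ} {G' : MarkedGraph V' Θ Ξ} {W j : ℕ}
    {x : V} {x' : V'} (h : G.code W (j + 1) x = G'.code W (j + 1) x') :
    G.code W j x = G'.code W j x' := congrArg Prod.fst h

theorem code_eq_of_le {G : MarkedGraph V Θ Ξ} {G' : MarkedGraph V' Θ Ξ} {W i j : ℕ} (hij : i ≤ j)
    {x : V} {x' : V'} (h : G.code W j x = G'.code W j x') :
    G.code W i x = G'.code W i x' := by
  induction hij with
  | refl => exact h
  | step _ ih => exact ih (code_eq_of_succ h)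

/-- Vertices of small degree with the same colour have the same kinds of neighbours. -/
theorem exists_equiv_of_code_eq {G : MarkedGraph V Θ Ξ} {G' : MarkedGraph V' Θ Ξ} {W j : ℕ}
    {x : V} {x' : V'} (hx : (G.graph.neighborSet x).Finite)
    (hx' : (G'.graph.neighborSet x').Finite) (hW : G.degree x ≤ W) (hW' : G'.degree x' ≤ W)
    (h : G.code W (j + 1) x = G'.code W (j + 1) x') :
    ∃ e : G.graph.neighborSet x ≃ G'.graph.neighborSet x',
      ∀ y, G'.nbrType (G'.code W j) x' (e y) = G.nbrType (G.code W j) x y := by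
  have := hx.to_subtype
  have := hx'.to_subtype
  refine exists_equiv_of_card_fiber_eq _ _ fun c => ?_
  have h1 := code_succ_snd G W j x hx hW c
  rw [h, code_succ_snd G' W j x' hx' hW' c] at h1
  exact h1.symm

/-- A map `φ` of marked graphs that preserves marks and is bijective on the neighbourhoods of
the vertices of height less than `r`, where the height `δ` grows at most by one along edges. -/
structure LocalIso (G : MarkedGraph V Θ Ξ) (G' : MarkedGraph V' Θ Ξ) (φ : V → V') (δ : V → ℕ)
    (r : ℕ) : Prop where
  mark : ∀ x, G'.vertexMark (φ x) = G.vertexMark x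
  bij : ∀ x, δ x < r → Set.BijOn φ (G.graph.neighborSet x) (G'.graph.neighborSet (φ x))
  edge : ∀ x y h h', G'.edgeMark (φ x) (φ y) h' = G.edgeMark x y h
  step : ∀ x y, G.graph.Adj x y → δ y ≤ δ x + 1

namespace LocalIso

variable {G : MarkedGraph V Θ Ξ} {G' : MarkedGraph V' Θ Ξ} {φ : V → V'} {δ : V → ℕ} {r : ℕ}

theorem nbrType_eq (h : LocalIso G G' φ δ r) {x : V} (y : G.graph.neighborSet x)
    (y' : G'.graph.neighborSet (φ x)) (hy : (y' : V') = φ y) {κ : V → B} {κ' : V' → B}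
    (hκ : κ' (φ y) = κ y) : G'.nbrType κ' (φ x) y' = G.nbrType κ x y := by
  obtain ⟨y', hy'⟩ := y'
  obtain rfl : y' = φ y := hy
  exact Prod.ext (h.edge x y _ _) (Prod.ext (h.edge y x _ _) hκ)

theorem code_eq (h : LocalIso G G' φ δ r) (W j : ℕ) :
    ∀ x, δ x + j ≤ r → G'.code W j (φ x) = G.code W j x := by
  induction j with
  | zero => exact fun x _ => congrArg ULift.up (h.mark x)
  | succ j ih =>
    intro x hx
    refine code_succ_congr (ih x (by omega)) ((h.bij x (by omega)).equiv φ) fun y => ?_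
    refine h.nbrType_eq y _ rfl (ih y ?_)
    have := h.step x y y.2
    omega

theorem degree_eq (h : LocalIso G G' φ δ r) (x : V) (hx : δ x < r) :
    G'.degree (φ x) = G.degree x := by
  rw [degree, degree, ← (h.bij x hx).image_eq, Set.InjOn.ncard_image (h.bij x hx).injOn]

end LocalIso

end MarkedGraph

namespace PreRooted

variable {Θ : Type u} {Ξ : Type v}

theorem dist_le_succ_of_adj (A : PreRooted Θ Ξ) {x y : A.V} (h : A.G.graph.Adj x y) :
    A.G.graph.dist A.root y ≤ A.G.graph.dist A.root x + 1 := by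
  have := A.connected.dist_triangle (u := A.root) (v := x) (w := y)
  rwa [SimpleGraph.dist_eq_one_iff_adj.2 h] at this

theorem localIso_trunc (A : PreRooted Θ Ξ) (r : ℕ) :
    MarkedGraph.LocalIso (A.trunc r).G A.G Subtype.val
      (fun x : A.ball r => A.G.graph.dist A.root x) r where
  mark _ := rfl
  bij x hx := by
    refine ⟨fun y hy => hy, Subtype.val_injective.injOn, fun y hy => ?_⟩
    have h1 : A.G.graph.Adj x.1 y := hy
    have h2 : A.G.graph.dist A.root y ≤ A.G.graph.dist A.root x.1 + 1 :=
      A.dist_le_succ_of_adj h1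
    exact ⟨⟨y, by show A.G.graph.dist A.root y ≤ r; omega⟩, h1, rfl⟩
  edge _ _ _ _ := rfl
  step _ _ h := A.dist_le_succ_of_adj h

theorem Iso.exists_localIso {A B : PreRooted Θ Ξ} (h : A.Iso B) (r : ℕ) :
    ∃ φ : A.V → B.V, φ A.root = B.root ∧ MarkedGraph.LocalIso A.G B.G φ (fun _ => 0) r := by
  obtain ⟨φ, h0, h1, h2⟩ := h
  refine ⟨φ, h0, h1, fun x _ => ?_, fun x y h h' => h2 x y h, fun _ _ _ => Nat.zero_le _⟩
  refine ⟨fun y hy => φ.map_adj_iff.2 hy, φ.injective.injOn, fun y hy => ?_⟩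
  refine ⟨φ.symm y, ?_, φ.apply_symm_apply y⟩
  have h3 : B.G.graph.Adj (φ x) (φ (φ.symm y)) := by rwa [φ.apply_symm_apply]
  exact φ.map_adj_iff.1 h3

end PreRooted

namespace MarkedGraph

variable {V : Type} {Θ : Type u} {Ξ : Type v}

theorem localIso_component [Finite V] (G : MarkedGraph V Θ Ξ) (x : V) (r : ℕ) :
    LocalIso (G.component x).G G Subtype.val (fun _ => 0) r where
  mark _ := rfl
  bij y _ := ⟨fun _ hz => hz, Subtype.val_injective.injOn, fun z hz =>
    ⟨⟨z, y.2.trans (SimpleGraph.Adj.reachable hz)⟩, hz, rfl⟩⟩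
  edge _ _ _ _ := rfl
  step _ _ _ := Nat.zero_le _

end MarkedGraph

/-! ### Tree-like balls are determined by the colour of the root -/

namespace PreRooted

variable {Θ : Type u} {Ξ : Type v}

/-- The ball of radius `k` around the root is a tree: no vertex of the ball has two different
neighbours that are at least as close to the root. -/
def TreeLike (k : ℕ) (A : PreRooted Θ Ξ) : Prop :=
  ∀ x y y', A.G.graph.dist A.root x ≤ k → A.G.graph.Adj x y → A.G.graph.Adj x y' →
    A.G.graph.dist A.root y ≤ A.G.graph.dist A.root x →
    A.G.graph.dist A.root y' ≤ A.G.graph.dist A.root x → y = y'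

theorem exists_path_concat (A : PreRooted Θ Ξ) {x y : A.V} (h : A.G.graph.Adj y x)
    (hd : A.G.graph.dist A.root y ≤ A.G.graph.dist A.root x) :
    ∃ p : A.G.graph.Walk A.root y, (p.concat h).IsPath ∧
      p.length ≤ A.G.graph.dist A.root x := by
  classical
  obtain ⟨p, hp, hl⟩ := A.connected.exists_path_of_dist A.root y
  refine ⟨p, hp.concat (fun hx => ?_) h, hl.trans_le hd⟩
  have h1 := SimpleGraph.dist_le (p.takeUntil x hx)
  have h2 := p.length_takeUntil_lt_length hx h.ne'
  omega

theorem treeLike_of_path_unique {A : PreRooted Θ Ξ} {k : ℕ}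
    (h : ∀ x (p q : A.G.graph.Walk A.root x), p.IsPath → q.IsPath → p.length ≤ k + 1 →
      q.length ≤ k + 1 → p = q) : A.TreeLike k := by
  intro x y y' hx hy hy' hd hd'
  obtain ⟨p, hp, hpl⟩ := A.exists_path_concat hy.symm hd
  obtain ⟨q, hq, hql⟩ := A.exists_path_concat hy'.symm hd'
  have := h x _ _ hp hq (by rw [SimpleGraph.Walk.length_concat]; omega)
    (by rw [SimpleGraph.Walk.length_concat]; omega)
  exact (SimpleGraph.Walk.concat_inj this).1

theorem treeLike_of_isTree {A : PreRooted Θ Ξ} (h : A.G.graph.IsTree) (k : ℕ) : A.TreeLike k :=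
  treeLike_of_path_unique fun x p q hp hq _ _ => by
    have := (h.isAcyclic.subsingleton_path A.root x).elim ⟨p, hp⟩ ⟨q, hq⟩
    exact congrArg Subtype.val this

theorem exists_parent (A : PreRooted Θ Ξ) {x : A.V} {j : ℕ}
    (h : A.G.graph.dist A.root x = j + 1) :
    ∃ y, A.G.graph.Adj y x ∧ A.G.graph.dist A.root y = j := by
  obtain ⟨p, hp⟩ := A.connected.exists_walk_length_eq_dist A.root x
  rw [h] at hp
  obtain ⟨y, q, h', rfl⟩ := p.exists_eq_concat (by omega)
  rw [SimpleGraph.Walk.length_concat] at hp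
  have h1 := SimpleGraph.dist_le q
  have h2 := A.dist_le_succ_of_adj h'
  exact ⟨y, h', by omega⟩

/-- A map that restricts to an isomorphism, preserving marks, between the balls of radius `j`
around the roots, where these balls are trees; the colours of the vertices agree as far as they
are determined by the balls of radius `k`. -/
structure BallIso (A B : PreRooted Θ Ξ) (W k j : ℕ) (φ : A.V → B.V) : Prop where
  root : φ A.root = B.root
  dist : ∀ x, A.G.graph.dist A.root x ≤ j →
    B.G.graph.dist B.root (φ x) = A.G.graph.dist A.root x
  code : ∀ x, A.G.graph.dist A.root x ≤ j →
    A.G.code W (k - A.G.graph.dist A.root x) x = B.G.code W (k - A.G.graph.dist A.root x) (φ x)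
  inj : ∀ x y, A.G.graph.dist A.root x ≤ j → A.G.graph.dist A.root y ≤ j → φ x = φ y → x = y
  surj : ∀ y, B.G.graph.dist B.root y ≤ j → ∃ x, A.G.graph.dist A.root x ≤ j ∧ φ x = y
  adj : ∀ x y (h : A.G.graph.Adj x y), A.G.graph.dist A.root x ≤ j →
    A.G.graph.dist A.root y ≤ j → ∃ h' : B.G.graph.Adj (φ x) (φ y),
      B.G.edgeMark _ _ h' = A.G.edgeMark x y h

/-- Vertices with the same colour have matching neighbourhoods, and the matching can be chosen to
send a given neighbour to a given neighbour of the same kind. -/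
theorem exists_equiv_extending {A B : PreRooted Θ Ξ} {W i : ℕ} (hA : ∀ x, A.G.degree x ≤ W)
    (hB : ∀ x, B.G.degree x ≤ W) {x : A.V} {x' : B.V}
    (h : A.G.code W (i + 1) x = B.G.code W (i + 1) x') (p : A.G.graph.neighborSet x)
    (p' : B.G.graph.neighborSet x')
    (hp : B.G.nbrType (B.G.code W i) x' p' = A.G.nbrType (A.G.code W i) x p) :
    ∃ e : A.G.graph.neighborSet x ≃ B.G.graph.neighborSet x', e p = p' ∧
      ∀ y, B.G.nbrType (B.G.code W i) x' (e y) = A.G.nbrType (A.G.code W i) x y := by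
  classical
  obtain ⟨e, he⟩ := MarkedGraph.exists_equiv_of_code_eq (A.locallyFinite x) (B.locallyFinite x')
    (hA x) (hB x') h
  refine ⟨e.trans (Equiv.swap (e p) p'), by simp, fun y => ?_⟩
  rw [Equiv.trans_apply]
  by_cases h1 : e y = e p
  · rw [h1, Equiv.swap_apply_left, hp, e.injective h1]
  by_cases h2 : e y = p'
  · rw [h2, Equiv.swap_apply_right, ← he y, he p, h2, hp]
  · rw [Equiv.swap_apply_of_ne_of_ne h1 h2, he]

/-- The bijection between the neighbourhoods of corresponding vertices on the boundary of a
ball that is used to extend an isomorphism of balls by one level. -/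
theorem BallIso.exists_equiv {A B : PreRooted Θ Ξ} {W k j : ℕ} {φ : A.V → B.V}
    (hφ : BallIso A B W k j φ) (hjk : j < k) (hA : ∀ x, A.G.degree x ≤ W)
    (hB : ∀ x, B.G.degree x ≤ W) (tA : A.TreeLike k) (x : A.V)
    (hx : A.G.graph.dist A.root x = j) :
    ∃ e : A.G.graph.neighborSet x ≃ B.G.graph.neighborSet (φ x),
      (∀ y : A.G.graph.neighborSet x, A.G.graph.dist A.root y ≤ j → (e y : B.V) = φ y) ∧
      ∀ y, B.G.nbrType (B.G.code W (k - (j + 1))) (φ x) (e y) =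
        A.G.nbrType (A.G.code W (k - (j + 1))) x y := by
  have hc := hφ.code x hx.le
  rw [hx, show k - j = k - (j + 1) + 1 by omega] at hc
  by_cases hp : ∃ p, A.G.graph.Adj x p ∧ A.G.graph.dist A.root p ≤ j
  · obtain ⟨p, hxp, hpj⟩ := hp
    obtain ⟨h1, h2⟩ := hφ.adj x p hxp hx.le hpj
    obtain ⟨h1', h2'⟩ := hφ.adj p x hxp.symm hpj hx.le
    have h3 := MarkedGraph.code_eq_of_le (show k - (j + 1) ≤ k - A.G.graph.dist A.root p by omega)
      (hφ.code p hpj)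
    obtain ⟨e, he, he'⟩ := exists_equiv_extending hA hB hc ⟨p, hxp⟩ ⟨φ p, h1⟩
      (Prod.ext h2 (Prod.ext h2' h3.symm))
    refine ⟨e, fun y hy => ?_, he'⟩
    obtain rfl : y = ⟨p, hxp⟩ :=
      Subtype.ext (tA x y p (hx.trans_le hjk.le) y.2 hxp (hx ▸ hy) (hx ▸ hpj))
    rw [he]
  · obtain ⟨e, he⟩ := MarkedGraph.exists_equiv_of_code_eq (A.locallyFinite x)
      (B.locallyFinite (φ x)) (hA x) (hB _) hc
    exact ⟨e, fun y hy => absurd ⟨y, y.2, hy⟩ hp, he⟩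

/-- An isomorphism of tree-like balls extends by one level: the new vertices adjacent to a boundary
vertex `x` are matched with those adjacent to its image, which have the same colours. -/
theorem BallIso.exists_succ {A B : PreRooted Θ Ξ} {W k j : ℕ} {φ : A.V → B.V}
    (hφ : BallIso A B W k j φ) (hjk : j < k) (hA : ∀ x, A.G.degree x ≤ W)
    (hB : ∀ x, B.G.degree x ≤ W) (tA : A.TreeLike k) (tB : B.TreeLike k) :
    ∃ φ', BallIso A B W k (j + 1) φ' := by
  classical
  choose! par hpar hpard using fun x (h : A.G.graph.dist A.root x = j + 1) => A.exists_parent h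
  -- the matching of neighbours, as a function on all vertices
  have key : ∀ x, ∃ e : A.V → B.V, A.G.graph.dist A.root x = j →
      (∀ y, A.G.graph.Adj x y → B.G.graph.Adj (φ x) (e y)) ∧
      (∀ y z, A.G.graph.Adj x y → A.G.graph.Adj x z → e y = e z → y = z) ∧
      (∀ w, B.G.graph.Adj (φ x) w → ∃ y, A.G.graph.Adj x y ∧ e y = w) ∧
      (∀ y, A.G.graph.Adj x y → A.G.graph.dist A.root y ≤ j → e y = φ y) ∧
      (∀ y (h : A.G.graph.Adj x y) (h' : B.G.graph.Adj (φ x) (e y)),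
        B.G.edgeMark _ _ h' = A.G.edgeMark _ _ h ∧
        B.G.edgeMark _ _ h'.symm = A.G.edgeMark _ _ h.symm) ∧
      (∀ y, A.G.graph.Adj x y →
        B.G.code W (k - (j + 1)) (e y) = A.G.code W (k - (j + 1)) y) := by
    intro x
    by_cases hx : A.G.graph.dist A.root x = j
    · obtain ⟨e, he1, he2⟩ := hφ.exists_equiv hjk hA hB tA x hx
      have hval : ∀ y (h : A.G.graph.Adj x y),
          (if h : A.G.graph.Adj x y then (e ⟨y, h⟩ : B.V) else B.root) = e ⟨y, h⟩ :=
        fun y h => dif_pos h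
      refine ⟨fun y => if h : A.G.graph.Adj x y then (e ⟨y, h⟩ : B.V) else B.root, fun _ =>
        ⟨fun y h => ?_, fun y z h h' heq => ?_, fun w hw => ?_, fun y h hy => ?_,
          fun y h => ?_, fun y h => ?_⟩⟩
      · simp only [hval y h]
        exact (e ⟨y, h⟩).2
      · simp only [hval y h, hval z h'] at heq
        exact congrArg Subtype.val (e.injective (Subtype.ext heq))
      · refine ⟨e.symm ⟨w, hw⟩, (e.symm ⟨w, hw⟩).2, ?_⟩
        simp only [hval _ (e.symm ⟨w, hw⟩).2]
        simp
      · simp only [hval y h]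
        exact he1 ⟨y, h⟩ hy
      · simp only [hval y h]
        intro h'
        have := he2 ⟨y, h⟩
        exact ⟨congrArg Prod.fst this, congrArg (fun c => c.2.1) this⟩
      · simp only [hval y h]
        exact congrArg (fun c => c.2.2) (he2 ⟨y, h⟩)
    · exact ⟨fun _ => B.root, fun h => absurd h hx⟩
  choose e he using key
  set φ' : A.V → B.V := fun z => if A.G.graph.dist A.root z ≤ j then φ z else e (par z) z with hφ'
  have hold : ∀ z, A.G.graph.dist A.root z ≤ j → φ' z = φ z := fun z hz => if_pos hz
  have hnew : ∀ z, A.G.graph.dist A.root z = j + 1 → φ' z = e (par z) z := fun z hz =>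
    if_neg (by omega)
  have hnewadj : ∀ z, A.G.graph.dist A.root z = j + 1 → B.G.graph.Adj (φ (par z)) (φ' z) := by
    intro z hz
    rw [hnew z hz]
    exact (he (par z) (hpard z hz)).1 z (hpar z hz)
  have hdist : ∀ z, A.G.graph.dist A.root z ≤ j + 1 →
      B.G.graph.dist B.root (φ' z) = A.G.graph.dist A.root z := by
    intro z hz
    rcases Nat.lt_or_ge j (A.G.graph.dist A.root z) with h | h
    · have hz : A.G.graph.dist A.root z = j + 1 := by omega
      have hx := hpard z hz
      have hdx := hφ.dist _ hx.le
      have hadj := hnewadj z hz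
      have h1 := B.dist_le_succ_of_adj hadj
      by_contra hne
      have h2 : B.G.graph.dist B.root (φ' z) ≤ j := by omega
      -- the image of `z` would be the parent of the image of the parent of `z`
      obtain ⟨w, hw, hwz⟩ := hφ.surj _ h2
      have hwx : A.G.graph.Adj (par z) w := by
        rcases Nat.eq_zero_or_pos j with rfl | hj
        · have h3 : B.root = φ' z := B.connected.dist_eq_zero_iff.1 (Nat.le_zero.1 h2)
          have h4 : A.root = par z := A.connected.dist_eq_zero_iff.1 hx
          rw [← h3, ← h4, hφ.root] at hadj
          exact absurd rfl hadj.ne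
        · obtain ⟨i, rfl⟩ := Nat.exists_eq_add_of_le' hj
          obtain ⟨q, hq, hqd⟩ := A.exists_parent hx
          obtain ⟨h3, -⟩ := hφ.adj _ _ hq.symm hx.le (by omega)
          have h4 := tB (φ (par z)) (φ q) (φ' z) (by omega) h3 hadj
            (by rw [hφ.dist q (by omega)]; omega) (by omega)
          rw [← hwz] at h4
          rw [← hφ.inj q w (by omega) hw h4]
          exact hq.symm
      have h5 := (he (par z) hx).2.2.2.1 w hwx hw
      rw [hwz, hnew z hz] at h5
      have h6 := (he (par z) hx).2.1 w z hwx (hpar z hz) h5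
      rw [h6] at hw
      omega
    · rw [hold z h, hφ.dist z h]
  have hpareq : ∀ x y, A.G.graph.Adj x y → A.G.graph.dist A.root x ≤ j + 1 →
      A.G.graph.dist A.root y = j + 1 → x = par y := by
    intro x y h hx hy
    exact tA y x (par y) (by omega) h.symm (hpar y hy).symm (by omega)
      (by rw [hpard y hy]; omega)
  refine ⟨φ', ?_, hdist, ?_, ?_, ?_, ?_⟩
  · rw [hold _ (by simp), hφ.root]
  · intro z hz
    rcases Nat.lt_or_ge j (A.G.graph.dist A.root z) with h | h
    · have hz : A.G.graph.dist A.root z = j + 1 := by omega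
      rw [hz, hnew z hz]
      exact ((he (par z) (hpard z hz)).2.2.2.2.2 z (hpar z hz)).symm
    · rw [hold z h]
      exact hφ.code z h
  · intro x y hx hy hxy
    have hd := hdist x hx
    rw [hxy, hdist y hy] at hd
    rcases Nat.lt_or_ge j (A.G.graph.dist A.root x) with h | h
    · have hx1 : A.G.graph.dist A.root x = j + 1 := by omega
      have hy1 : A.G.graph.dist A.root y = j + 1 := by omega
      have h1 := hnewadj x hx1
      have h2 := hnewadj y hy1
      have h3 := hpard x hx1
      have h4 := hpard y hy1
      rw [← hxy] at h2
      have h5 := tB (φ' x) _ _ (by rw [hdist x hx]; omega) h1.symm h2.symm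
        (by rw [hdist x hx, hφ.dist _ h3.le]; omega) (by rw [hdist x hx, hφ.dist _ h4.le]; omega)
      have h6 := hφ.inj _ _ h3.le h4.le h5
      rw [hnew x hx1, hnew y hy1, ← h6] at hxy
      exact (he (par x) h3).2.1 x y (hpar x hx1) (h6 ▸ hpar y hy1) hxy
    · rw [hold x h, hold y (by omega)] at hxy
      exact hφ.inj x y h (by omega) hxy
  · intro w hw
    rcases Nat.lt_or_ge j (B.G.graph.dist B.root w) with h | h
    · have hw1 : B.G.graph.dist B.root w = j + 1 := by omega
      obtain ⟨w0, hw0, hwd⟩ := B.exists_parent hw1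
      obtain ⟨x, hx, rfl⟩ := hφ.surj w0 hwd.le
      rw [hφ.dist x hx] at hwd
      obtain ⟨z, hz, rfl⟩ := (he x hwd).2.2.1 w hw0
      have hzd : A.G.graph.dist A.root z = j + 1 := by
        have h1 := A.dist_le_succ_of_adj hz
        by_contra hne
        have h2 : A.G.graph.dist A.root z ≤ j := by omega
        have h3 := (he x hwd).2.2.2.1 z hz h2
        rw [h3, hφ.dist z h2] at hw1
        exact hne hw1
      refine ⟨z, hzd.le, ?_⟩
      rw [hnew z hzd, ← hpareq x z hz (by omega) hzd]
    · obtain ⟨x, hx, rfl⟩ := hφ.surj w h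
      exact ⟨x, by omega, hold x hx⟩
  · -- an edge that is not in the smaller ball joins a new vertex to its parent
    have hnewmark : ∀ x y (h : A.G.graph.Adj x y), A.G.graph.dist A.root x ≤ j + 1 →
        A.G.graph.dist A.root y = j + 1 → ∃ h' : B.G.graph.Adj (φ' x) (φ' y),
          B.G.edgeMark _ _ h' = A.G.edgeMark x y h ∧
          B.G.edgeMark _ _ h'.symm = A.G.edgeMark y x h.symm := by
      intro x y h hx hy
      have h1 := hpareq x y h hx hy
      have h2 := hpard y hy
      rw [← h1] at h2
      have h3 := (he x h2).1 y h
      have h4 : φ' x = φ x := hold x h2.le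
      have h5 : φ' y = e x y := by rw [hnew y hy, ← h1]
      have h6 : B.G.graph.Adj (φ' x) (φ' y) := by rw [h4, h5]; exact h3
      have h7 := (he x h2).2.2.2.2.1 y h h3
      refine ⟨h6, ?_, ?_⟩
      · rw [← h7.1]
        exact edgeMark_congr _ h4 h5 _ _
      · rw [← h7.2]
        exact edgeMark_congr _ h5 h4 _ _
    intro x y h hx hy
    rcases Nat.lt_or_ge j (A.G.graph.dist A.root y) with hy1 | hy1
    · obtain ⟨h', h1, -⟩ := hnewmark x y h hx (by omega)
      exact ⟨h', h1⟩
    · rcases Nat.lt_or_ge j (A.G.graph.dist A.root x) with hx1 | hx1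
      · obtain ⟨h', -, h1⟩ := hnewmark y x h.symm hy (by omega)
        exact ⟨h'.symm, h1⟩
      · obtain ⟨h1, h2⟩ := hφ.adj x y h hx1 hy1
        have h3 : B.G.graph.Adj (φ' x) (φ' y) := by rw [hold x hx1, hold y hy1]; exact h1
        refine ⟨h3, ?_⟩
        rw [← h2]
        exact edgeMark_congr _ (hold x hx1) (hold y hy1) _ _

theorem exists_ballIso {A B : PreRooted Θ Ξ} {W k : ℕ} (hA : ∀ x, A.G.degree x ≤ W)
    (hB : ∀ x, B.G.degree x ≤ W) (tA : A.TreeLike k) (tB : B.TreeLike k)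
    (h : A.G.code W k A.root = B.G.code W k B.root) (j : ℕ) (hj : j ≤ k) :
    ∃ φ, BallIso A B W k j φ := by
  induction j with
  | zero =>
    have h0 : ∀ x, A.G.graph.dist A.root x ≤ 0 → x = A.root := fun x hx =>
      (A.connected.dist_eq_zero_iff.1 (Nat.le_zero.1 hx)).symm
    refine ⟨fun _ => B.root, rfl, fun x hx => ?_, fun x hx => ?_, fun x y hx hy _ => ?_,
      fun y hy => ?_, fun x y hxy hx hy => ?_⟩
    · rw [h0 x hx]; simp
    · rw [h0 x hx, SimpleGraph.dist_self, Nat.sub_zero]; exact h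
    · rw [h0 x hx, h0 y hy]
    · exact ⟨A.root, by simp, B.connected.dist_eq_zero_iff.1 (Nat.le_zero.1 hy)⟩
    · exact absurd ((h0 x hx).trans (h0 y hy).symm) hxy.ne
  | succ j ih =>
    obtain ⟨φ, hφ⟩ := ih (by omega)
    exact hφ.exists_succ (by omega) hA hB tA tB

/-- Tree-like balls of bounded degree with the same root colour are isomorphic. -/
theorem trunc_iso_of_code_eq {A B : PreRooted Θ Ξ} {W k : ℕ} (hA : ∀ x, A.G.degree x ≤ W)
    (hB : ∀ x, B.G.degree x ≤ W) (tA : A.TreeLike k) (tB : B.TreeLike k)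
    (h : A.G.code W k A.root = B.G.code W k B.root) : (A.trunc k).Iso (B.trunc k) := by
  obtain ⟨φ, hφ⟩ := exists_ballIso hA hB tA tB h k le_rfl
  have hmem : ∀ x : A.ball k, φ x ∈ B.ball k := fun x => by
    show B.G.graph.dist B.root (φ x) ≤ k
    rw [hφ.dist x x.2]
    exact x.2
  have hbij : Function.Bijective fun x : A.ball k => (⟨φ x, hmem x⟩ : B.ball k) := by
    refine ⟨fun x y hxy => ?_, fun y => ?_⟩
    · exact Subtype.ext (hφ.inj x y x.2 y.2 (congrArg Subtype.val hxy))
    · obtain ⟨x, hx, hxy⟩ := hφ.surj y y.2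
      exact ⟨⟨x, hx⟩, Subtype.ext hxy⟩
  -- an edge in the image joins a vertex to the image of its parent
  have hback : ∀ x y, A.G.graph.dist A.root x ≤ A.G.graph.dist A.root y →
      A.G.graph.dist A.root y ≤ k → B.G.graph.Adj (φ x) (φ y) → A.G.graph.Adj x y := by
    intro x y hxy hy hadj
    have dx := hφ.dist x (hxy.trans hy)
    have dy := hφ.dist y hy
    rcases Nat.eq_zero_or_pos (A.G.graph.dist A.root y) with h0 | h0
    · have h1 : A.root = y := A.connected.dist_eq_zero_iff.1 h0
      have h2 : A.root = x := A.connected.dist_eq_zero_iff.1 (by omega)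
      rw [← h1, ← h2] at hadj
      exact absurd rfl hadj.ne
    · obtain ⟨i, hi⟩ := Nat.exists_eq_add_of_le' h0
      obtain ⟨q, hq, hqd⟩ := A.exists_parent hi
      obtain ⟨h3, -⟩ := hφ.adj q y hq (by omega) hy
      have dq := hφ.dist q (by omega)
      have h4 := tB (φ y) (φ x) (φ q) (by omega) hadj.symm h3.symm (by omega) (by omega)
      rw [hφ.inj x q (by omega) (by omega) h4]
      exact hq
  refine ⟨⟨Equiv.ofBijective _ hbij, fun {x y} => ⟨fun hxy => ?_, fun hxy => ?_⟩⟩, ?_, fun x => ?_,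
    fun x y hxy => ?_⟩
  · have hxy' : B.G.graph.Adj (φ x.1) (φ y.1) := hxy
    show A.G.graph.Adj x.1 y.1
    rcases le_total (A.G.graph.dist A.root x.1) (A.G.graph.dist A.root y.1) with h1 | h1
    · exact hback _ _ h1 y.2 hxy'
    · exact (hback _ _ h1 x.2 hxy'.symm).symm
  · exact (hφ.adj x.1 y.1 hxy x.2 y.2).1
  · exact Subtype.ext hφ.root
  · have h1 := congrArg Code.mark (hφ.code x.1 x.2)
    rw [MarkedGraph.mark_code, MarkedGraph.mark_code] at h1
    exact h1.symm
  · exact (hφ.adj x.1 y.1 hxy x.2 y.2).2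

end PreRooted

/-! ### Matching half-edges greedily without creating short cycles -/

namespace MarkedGraph

variable {V : Type} {Θ : Type u} {Ξ : Type v} {B : Type*}

theorem nbrCount_eq_ncard (G : MarkedGraph V Θ Ξ) (κ : V → B) (x : V) (ξ ξ' : Ξ) (b : B) :
    G.nbrCount κ x (ξ, ξ', b) = {y | (∃ h : G.graph.Adj x y, G.edgeMark x y h = ξ ∧
      G.edgeMark y x h.symm = ξ') ∧ κ y = b}.ncard := by
  rw [nbrCount, ← Nat.card_coe_set_eq]
  refine Nat.card_congr ⟨fun y => ⟨y.1, ?_⟩, fun y => ⟨⟨y.1, y.2.1.1⟩, ?_⟩, fun _ => rfl,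
    fun _ => rfl⟩
  · have h := y.2
    rw [nbrType, Prod.mk.injEq, Prod.mk.injEq] at h
    exact ⟨⟨y.1.2, h.1, h.2.1⟩, h.2.2⟩
  · obtain ⟨⟨h, h1, h2⟩, h3⟩ := y.2
    rw [nbrType, Prod.mk.injEq, Prod.mk.injEq]
    exact ⟨h1, h2, h3⟩

open Classical in
/-- The marked graph obtained by adding an edge from `u` to `w` with marks `ξ` and `ξ'`. -/
noncomputable def addEdge (G : MarkedGraph V Θ Ξ) (u w : V) (ξ ξ' : Ξ) : MarkedGraph V Θ Ξ where
  graph := G.graph ⊔ SimpleGraph.edge u w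
  vertexMark := G.vertexMark
  edgeMark x y _ := if h : G.graph.Adj x y then G.edgeMark x y h else if x = u then ξ else ξ'

open Classical in
theorem nbrCount_addEdge_le [Finite V] (G : MarkedGraph V Θ Ξ) (κ : V → B) {u w : V} (huw : u ≠ w)
    (h : ¬ G.graph.Adj u w) (ξ ξ' : Ξ) (z : V) (c : Ξ × Ξ × B) :
    (G.addEdge u w ξ ξ').nbrCount κ z c ≤ G.nbrCount κ z c +
      (if z = u ∧ c = (ξ, ξ', κ w) then 1 else 0) +
      (if z = w ∧ c = (ξ', ξ, κ u) then 1 else 0) := by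
  obtain ⟨η, η', b⟩ := c
  rw [nbrCount_eq_ncard, nbrCount_eq_ncard]
  set S := {y | (∃ h : G.graph.Adj z y, G.edgeMark z y h = η ∧
      G.edgeMark y z h.symm = η') ∧ κ y = b}
  have hsub : {y | (∃ h : (G.addEdge u w ξ ξ').graph.Adj z y,
      (G.addEdge u w ξ ξ').edgeMark z y h = η ∧
      (G.addEdge u w ξ ξ').edgeMark y z h.symm = η') ∧ κ y = b} ⊆
      S ∪ (if z = u ∧ (η, η', b) = (ξ, ξ', κ w) then {w} else ∅) ∪
        (if z = w ∧ (η, η', b) = (ξ', ξ, κ u) then {u} else ∅) := by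
    rintro y ⟨⟨hy, h1, h2⟩, h3⟩
    by_cases hzy : G.graph.Adj z y
    · refine Or.inl (Or.inl ⟨⟨hzy, ?_, ?_⟩, h3⟩)
      · simpa [addEdge, hzy] using h1
      · simpa [addEdge, hzy.symm] using h2
    · have hyz : ¬ G.graph.Adj y z := fun h' => hzy h'.symm
      simp only [addEdge, hzy, hyz, dif_neg, not_false_eq_true] at h1 h2
      rcases (SimpleGraph.sup_edge_adj_iff huw z y).1 hy with h4 | ⟨rfl, rfl⟩ | ⟨rfl, rfl⟩
      · exact absurd h4 hzy
      · refine Or.inl (Or.inr ?_)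
        rw [if_neg huw.symm] at h2
        rw [if_pos rfl] at h1
        rw [if_pos ⟨rfl, by rw [h1, h2, h3]⟩]
        rfl
      · refine Or.inr ?_
        rw [if_neg huw.symm] at h1
        rw [if_pos rfl] at h2
        rw [if_pos ⟨rfl, by rw [h1, h2, h3]⟩]
        rfl
  refine (Set.ncard_le_ncard hsub (Set.toFinite _)).trans ((Set.ncard_union_le _ _).trans
    (add_le_add ((Set.ncard_union_le _ _).trans (add_le_add le_rfl ?_)) ?_))
  · split_ifs <;> simp
  · split_ifs <;> simp

open Classical in
/-- The number of half-edges with marks `ξ, ξ'` at vertices of colour `a` that ask for a neighbour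
of colour `b`, if `D x c` is the number of half-edges of kind `c` at `x`. -/
noncomputable def halfEdges [Fintype V] (β : V → B) (D : V → Ξ × Ξ × B → ℕ) (a : B) (ξ ξ' : Ξ)
    (b : B) : ℕ :=
  ∑ x with β x = a, D x (ξ, ξ', b)

/-- The half-edges of a marked graph come in pairs of opposite kinds. -/
theorem halfEdges_nbrCount_comm [Fintype V] (G : MarkedGraph V Θ Ξ) (β : V → B) (a : B) (ξ ξ' : Ξ)
    (b : B) : halfEdges β (G.nbrCount β) a ξ ξ' b = halfEdges β (G.nbrCount β) b ξ' ξ a := by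
  classical
  let r : V → V → Prop := fun x y => ∃ h : G.graph.Adj x y, G.edgeMark x y h = ξ ∧
    G.edgeMark y x h.symm = ξ'
  have h := Finset.sum_card_bipartiteAbove_eq_sum_card_bipartiteBelow r
    (s := Finset.univ.filter fun x => β x = a) (t := Finset.univ.filter fun x => β x = b)
  rw [halfEdges, halfEdges]
  convert h using 2 with x hx x hx
  · rw [nbrCount_eq_ncard, ← Set.ncard_coe_finset]
    congr 1
    ext y
    simp [r, and_comm]
  · rw [nbrCount_eq_ncard, ← Set.ncard_coe_finset]
    congr 1
    ext y
    simp only [Finset.coe_bipartiteBelow, Finset.mem_filter, Finset.mem_univ, true_and, r,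
      Set.mem_ofPred_eq]
    constructor
    · rintro ⟨⟨h, h1, h2⟩, h3⟩
      exact ⟨h3, h.symm, h2, h1⟩
    · rintro ⟨h3, h, h1, h2⟩
      exact ⟨⟨h.symm, h2, h1⟩, h3⟩

/-- Half-edges of opposite kinds can be matched, without creating short cycles, until few of them
are left. In a maximal partial matching, the unmatched half-edges of opposite kinds are close to
each other, so that if both kinds occur then a ball contains all of them; hence the number of
unmatched half-edges is bounded up to the excess of one kind over the other. -/
theorem exists_matching [Fintype V] [Fintype Ξ] [Fintype B] (θ : V → Θ) (β : V → B)
    (D : V → Ξ × Ξ × B → ℕ) (M R : ℕ) (hM : ∀ x, ∑ c, D x c ≤ M) (hR : 1 ≤ R) :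
    ∃ G : MarkedGraph V Θ Ξ, G.vertexMark = θ ∧ G.graph.NoShortCycle R ∧
      (∀ x c, G.nbrCount β x c ≤ D x c) ∧
      ∀ a ξ ξ' b, halfEdges β (fun x c => D x c - G.nbrCount β x c) a ξ ξ' b ≤
        (M + 1) ^ R * M + (halfEdges β D a ξ ξ' b - halfEdges β D b ξ' ξ a) := by
  classical
  let P : MarkedGraph V Θ Ξ → Prop := fun G => G.vertexMark = θ ∧ G.graph.NoShortCycle R ∧
      (∀ x c, G.nbrCount β x c ≤ D x c)
  let S : Set ℕ := {n | ∃ G, P G ∧ G.graph.edgeSet.ncard = n}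
  have hS : S.Nonempty := by
    refine ⟨_, ⟨⊥, θ, fun _ _ h => absurd h (by simp)⟩, ⟨rfl, SimpleGraph.noShortCycle_bot R,
      fun x c => ?_⟩, rfl⟩
    rw [nbrCount, Nat.card_eq_zero.2 (Or.inl ⟨fun y => ?_⟩)]
    · exact Nat.zero_le _
    · exact y.1.2
  have hSb : BddAbove S := by
    refine ⟨Nat.card (Sym2 V), ?_⟩
    rintro _ ⟨G, -, rfl⟩
    exact Set.ncard_le_card _
  obtain ⟨G, ⟨hθ, hG, hGD⟩, hGS⟩ := Nat.sSup_mem hS hSb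
  refine ⟨G, hθ, hG, hGD, fun a ξ ξ' b => ?_⟩
  have hdeg : ∀ x, (G.graph.neighborSet x).ncard ≤ M := fun x => by
    refine le_trans ?_ (hM x)
    rw [← degree, ← G.sum_nbrCount β x (Set.toFinite _)]
    exact Finset.sum_le_sum fun c _ => hGD x c
  have hsplit : ∀ a ξ ξ' b, halfEdges β (fun x c => D x c - G.nbrCount β x c) a ξ ξ' b +
      halfEdges β (G.nbrCount β) a ξ ξ' b = halfEdges β D a ξ ξ' b := by
    intro a ξ ξ' b
    rw [halfEdges, halfEdges, halfEdges, ← Finset.sum_add_distrib]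
    exact Finset.sum_congr rfl fun x _ => Nat.sub_add_cancel (hGD x _)
  by_cases hw : ∃ w, β w = b ∧ G.nbrCount β w (ξ', ξ, a) < D w (ξ', ξ, a)
  · obtain ⟨w, hwb, hw⟩ := hw
    have hclose : ∀ u, β u = a → G.nbrCount β u (ξ, ξ', b) < D u (ξ, ξ', b) →
        ∃ p : G.graph.Walk w u, p.length ≤ R := by
      intro u hua hu
      by_contra hcon
      push Not at hcon
      have huw : u ≠ w := by
        rintro rfl
        have := hcon SimpleGraph.Walk.nil
        simp at this
      have hadj : ¬ G.graph.Adj u w := by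
        intro h
        have := hcon (SimpleGraph.Walk.cons h.symm SimpleGraph.Walk.nil)
        simp only [SimpleGraph.Walk.length_cons, SimpleGraph.Walk.length_nil] at this
        omega
      have hmem : (G.addEdge u w ξ ξ').graph.edgeSet.ncard ∈ S := by
        refine ⟨G.addEdge u w ξ ξ', ⟨hθ, hG.sup_edge fun p => ?_, fun z c => ?_⟩, rfl⟩
        · have := hcon p.reverse
          rwa [SimpleGraph.Walk.length_reverse] at this
        · have h1 := G.nbrCount_addEdge_le β huw hadj ξ ξ' z c
          rw [hwb, hua] at h1
          refine h1.trans ?_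
          by_cases hz : z = u ∧ c = (ξ, ξ', b)
          · obtain ⟨rfl, rfl⟩ := hz
            simpa [huw] using hu
          · by_cases hz' : z = w ∧ c = (ξ', ξ, a)
            · obtain ⟨rfl, rfl⟩ := hz'
              simpa [huw.symm] using hw
            · simpa [hz, hz'] using hGD z c
      have h1 := le_csSup hSb hmem
      rw [← hGS] at h1
      have h2 := Set.ncard_lt_ncard
        (SimpleGraph.edgeSet_strict_mono (SimpleGraph.lt_sup_edge G.graph u w huw hadj))
        (Set.toFinite _)
      exact absurd (h2.trans_le h1) (lt_irrefl _)
    have hball := SimpleGraph.ncard_walk_length_le hdeg w R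
    rw [Set.ncard_eq_toFinset_card'] at hball
    refine le_trans ?_ (Nat.le_add_right _ _)
    calc halfEdges β (fun x c => D x c - G.nbrCount β x c) a ξ ξ' b
        ≤ ∑ x ∈ {y | ∃ p : G.graph.Walk w y, p.length ≤ R}.toFinset, M := by
          rw [halfEdges]
          refine (Finset.sum_le_sum_of_ne_zero fun x hx h0 => ?_).trans
            (Finset.sum_le_sum fun x _ => ?_)
          · rw [Finset.mem_filter] at hx
            rw [Set.mem_toFinset]
            exact hclose x hx.2 (by omega)
          · exact (Nat.sub_le _ _).trans
              ((Finset.single_le_sum (fun _ _ => Nat.zero_le _) (Finset.mem_univ _)).trans (hM x))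
      _ ≤ (M + 1) ^ R * M := by
          rw [Finset.sum_const, smul_eq_mul]
          exact Nat.mul_le_mul_right _ hball
  · push Not at hw
    have h0 : halfEdges β (fun x c => D x c - G.nbrCount β x c) b ξ' ξ a = 0 := by
      refine Finset.sum_eq_zero fun x hx => ?_
      rw [Finset.mem_filter] at hx
      have := hw x hx.2
      show D x (ξ', ξ, a) - G.nbrCount β x (ξ', ξ, a) = 0
      omega
    have h1 := hsplit a ξ ξ' b
    have h2 := hsplit b ξ' ξ a
    have h3 := G.halfEdges_nbrCount_comm β a ξ ξ' b
    omega

end MarkedGraph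

/-! ### Finite graphs with prescribed degrees and prescribed colours -/

theorem SimpleGraph.Walk.exists_mem_edge_of_mem_edges {V : Type*} {G : SimpleGraph V} {x y : V}
    (p : G.Walk x y) {e : Sym2 V} (he : e ∈ p.edges) :
    ∃ a ∈ e, ∃ q : G.Walk x a, q.length < p.length := by
  induction p with
  | nil => simp at he
  | cons h p ih =>
    rw [edges_cons, List.mem_cons] at he
    rcases he with rfl | he
    · exact ⟨_, Sym2.mem_mk_left _ _, nil, by simp⟩
    · obtain ⟨a, ha, q, hq⟩ := ih he
      exact ⟨a, ha, cons h q, by simpa using hq⟩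

/-- The colour is the colour of a vertex of some locally finite graph in which the caps play no
role. -/
def Code.Realized {Θ : Type u} {Ξ : Type v} {W j : ℕ} (s : Code Θ Ξ W j) : Prop :=
  ∃ A : PreRooted Θ Ξ, (∀ x, A.G.degree x ≤ W) ∧ A.G.code W j A.root = s

/-- The degree recorded by a colour. -/
def Code.deg {Θ : Type u} {Ξ : Type v} {W j : ℕ} [Fintype Ξ] [Fintype (Code Θ Ξ W j)]
    (s : Code Θ Ξ W (j + 1)) : ℕ := ∑ c, (s.2 c : ℕ)

namespace MarkedGraph

variable {V : Type} {Θ : Type u} {Ξ : Type v}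

theorem deg_code {W j : ℕ} [Fintype Ξ] [Fintype (Code Θ Ξ W j)] (G : MarkedGraph V Θ Ξ) (x : V)
    (hx : (G.graph.neighborSet x).Finite) (hW : G.degree x ≤ W) :
    (G.code W (j + 1) x).deg = G.degree x := by
  rw [← G.sum_nbrCount (G.code W j) x hx]
  exact Finset.sum_congr rfl fun c _ => code_succ_snd G W j x hx hW c

/-- If the paths from `x` of length at most `k + 1` only use edges of a graph without short cycles,
then the ball of radius `k` around `x` is a tree. -/
theorem treeLike_component [Finite V] (G : MarkedGraph V Θ Ξ) {H : SimpleGraph V} {R k : ℕ}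
    (hH : H.NoShortCycle R) (hR : 2 * (k + 1) ≤ R) (x : V)
    (h : ∀ y (p : G.graph.Walk x y), p.length ≤ k → ∀ z, G.graph.Adj y z → H.Adj y z) :
    (G.component x).TreeLike k := by
  have hedge : ∀ y (p : G.graph.Walk x y), p.length ≤ k + 1 → ∀ e ∈ p.edges, e ∈ H.edgeSet := by
    intro y p hp e he
    obtain ⟨a, ha, q, hq⟩ := p.exists_mem_edge_of_mem_edges he
    obtain ⟨b, rfl⟩ := ha
    exact h a q (by omega) b (p.edges_subset_edgeSet he)
  let f : (G.component x).G.graph ↪g G.graph := SimpleGraph.Embedding.induce _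
  refine PreRooted.treeLike_of_path_unique fun y p q hp hq hpl hql => ?_
  have hp' := hp.map (f := f.toHom) f.injective
  have hq' := hq.map (f := f.toHom) f.injective
  rw [← SimpleGraph.Walk.length_map f.toHom] at hpl hql
  exact SimpleGraph.Walk.map_injective_of_injective f.injective _ _
    (hp'.eq_of_noShortCycle hH hR hq' hpl hql (hedge _ _ hpl) (hedge _ _ hql))

/-- If each vertex `x` near `v` has the right numbers of neighbours of each kind, as prescribed by
the realized colours `γ`, then `v` has colour `γ v`. -/
theorem code_eq_of_forall_nbrCount [Finite V] {W j : ℕ} (G : MarkedGraph V Θ Ξ)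
    (γ : V → Code Θ Ξ W (j + 1)) (hmark : ∀ x, G.vertexMark x = (γ x).mark) (F : Set V)
    (hF : ∀ x ∈ F, (γ x).Realized ∧ ∀ c, G.nbrCount (fun y => (γ y).1) x c = (γ x).2 c) (v : V)
    (hv : ∀ y (p : G.graph.Walk v y), p.length ≤ j → y ∈ F) : G.code W (j + 1) v = γ v := by
  -- compare `v` with a realization of its colour, one round of colour refinement at a time
  have step : ∀ i ≤ j, (∀ v, (∀ y (p : G.graph.Walk v y), p.length < i → y ∈ F) →
      ∀ (A : PreRooted Θ Ξ) (x : A.V), A.G.code W j x = (γ v).1 →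
        G.code W i v = A.G.code W i x) →
      ∀ v, (∀ y (p : G.graph.Walk v y), p.length < i + 1 → y ∈ F) →
      ∃ A : PreRooted Θ Ξ, A.G.code W (j + 1) A.root = γ v ∧
        G.code W (i + 1) v = A.G.code W (i + 1) A.root := by
    intro i hi ih v hv
    obtain ⟨⟨A, hAW, hA⟩, hcount⟩ := hF v (hv v .nil (by simp))
    have hA1 : A.G.code W j A.root = (γ v).1 := congrArg Prod.fst hA
    refine ⟨A, hA, ?_⟩
    have := (A.locallyFinite A.root).to_subtype
    obtain ⟨e, he⟩ := exists_equiv_of_card_fiber_eq (G.nbrType (fun y => (γ y).1) v)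
      (A.G.nbrType (A.G.code W j) A.root) fun c => by
        have h1 := code_succ_snd A.G W j A.root (A.locallyFinite A.root) (hAW _) c
        rw [hA, ← hcount c] at h1
        exact h1
    refine (code_succ_congr (ih v (fun y p hp => hv y p (by omega)) A _ hA1).symm e
      fun y => ?_).symm
    have h2 := he y
    simp only [nbrType, Prod.mk.injEq] at h2 ⊢
    exact ⟨h2.1, h2.2.1, (ih y (fun z p hp => hv z (.cons y.2 p)
      (Nat.succ_lt_succ hp)) A _ h2.2.2).symm⟩
  have claim : ∀ i ≤ j, ∀ v, (∀ y (p : G.graph.Walk v y), p.length < i → y ∈ F) →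
      ∀ (A : PreRooted Θ Ξ) (x : A.V), A.G.code W j x = (γ v).1 →
        G.code W i v = A.G.code W i x := by
    intro i
    induction i with
    | zero =>
      intro _ v _ A x h
      have h1 := congrArg Code.mark h
      rw [mark_code] at h1
      exact congrArg ULift.up ((hmark v).trans h1.symm)
    | succ i ih =>
      intro hi v hv A x h
      obtain ⟨A', h1, h2⟩ := step i (by omega) (ih (by omega)) v hv
      rw [h2]
      refine code_eq_of_le hi ?_
      rw [h]
      exact congrArg Prod.fst h1
  obtain ⟨A, h1, h2⟩ := step j le_rfl (claim j le_rfl) v fun y p hp => hv y p (by omega)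
  rw [h2, h1]

open Classical in
/-- Given a colour for each vertex such that half-edges of opposite kinds are nearly balanced,
there is a graph with prescribed degrees in which most vertices have the given colour and a
tree-like neighbourhood: match the half-edges greedily and repair the degrees by switching. -/
theorem exists_degree_eq_and_code_eq [Fintype Ξ] [Nonempty Ξ] (W j M : ℕ)
    [Fintype (Code Θ Ξ W j)] :
    ∃ K : ℕ, ∀ (V : Type) [Fintype V] (ℓ : V → ℕ) (_ : ∀ x, ℓ x ≤ M) (G₀ : SimpleGraph V)
      (_ : ∀ x, (G₀.neighborSet x).ncard = ℓ x) (γ : V → Code Θ Ξ W (j + 1)) (ok : Set V)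
      (_ : ∀ x ∈ ok, (γ x).Realized ∧ ℓ x = (γ x).deg),
      ∃ G : MarkedGraph V Θ Ξ, (∀ x, G.degree x = ℓ x) ∧
        {x | ¬ ((G.component x).TreeLike (j + 1) ∧ G.code W (j + 1) x = γ x)}.ncard ≤
          K * (1 + okᶜ.ncard + ∑ τ : Code Θ Ξ W j × Ξ × Ξ × Code Θ Ξ W j,
            (halfEdges (fun x => (γ x).1) (fun x c => if x ∈ ok then ((γ x).2 c : ℕ) else 0)
                τ.1 τ.2.1 τ.2.2.1 τ.2.2.2 -
              halfEdges (fun x => (γ x).1) (fun x c => if x ∈ ok then ((γ x).2 c : ℕ) else 0)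
                τ.2.2.2 τ.2.2.1 τ.2.1 τ.1)) := by
  set T := Fintype.card (Code Θ Ξ W j × Ξ × Ξ × Code Θ Ξ W j) with hT
  set R := 2 * (j + 1 + 1) with hR
  set C := (M + 1) ^ R * M with hC
  refine ⟨(3 * (T * C) + (2 * M + 2) * (M + 1) + 3 + 2 * M + 1) * (M + 1) ^ (j + 1), ?_⟩
  intro V _ ℓ hℓ G₀ hG₀ γ ok hok
  set β : V → Code Θ Ξ W j := fun x => (γ x).1 with hβ
  set D : V → Ξ × Ξ × Code Θ Ξ W j → ℕ := fun x c => if x ∈ ok then ((γ x).2 c : ℕ) else 0 with hD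
  set E := ∑ τ : Code Θ Ξ W j × Ξ × Ξ × Code Θ Ξ W j,
    (halfEdges β D τ.1 τ.2.1 τ.2.2.1 τ.2.2.2 - halfEdges β D τ.2.2.2 τ.2.2.1 τ.2.1 τ.1) with hE
  have hDok : ∀ x ∈ ok, ∑ c, D x c = ℓ x := by
    intro x hx
    rw [(hok x hx).2, Code.deg]
    exact Finset.sum_congr rfl fun c _ => if_pos hx
  have hDle : ∀ x, ∑ c, D x c ≤ ℓ x := by
    intro x
    by_cases hx : x ∈ ok
    · exact (hDok x hx).le
    · rw [Finset.sum_eq_zero fun c _ => if_neg hx]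
      exact Nat.zero_le _
  obtain ⟨H, hHmark, hHcycle, hHD, hHun⟩ := exists_matching (fun x => (γ x).mark) β D M R
    (fun x => (hDle x).trans (hℓ x)) (by omega)
  have hHdeg : ∀ x, (H.graph.neighborSet x).ncard = ∑ c, H.nbrCount β x c := fun x =>
    (H.sum_nbrCount β x (Set.toFinite _)).symm
  obtain ⟨G, hGdeg, hGH⟩ := SimpleGraph.exists_degrees_of_le ℓ M hℓ G₀ hG₀ H.graph fun x => by
    rw [hHdeg]
    exact (Finset.sum_le_sum fun c _ => hHD x c).trans (hDle x)
  -- the number of half-edges that remain unmatched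
  set U := ∑ x, ∑ c, (D x c - H.nbrCount β x c) with hU
  have hUle : U ≤ T * C + E := by
    have h1 : U = ∑ τ : Code Θ Ξ W j × Ξ × Ξ × Code Θ Ξ W j,
        halfEdges β (fun x c => D x c - H.nbrCount β x c) τ.1 τ.2.1 τ.2.2.1 τ.2.2.2 := by
      rw [Fintype.sum_prod_type_right, hU, Finset.sum_comm]
      refine Finset.sum_congr rfl fun c _ => ?_
      exact (Finset.sum_fiberwise_of_maps_to (fun x _ => Finset.mem_univ (β x)) _).symm
    rw [h1, hE, hT, ← smul_eq_mul, Fintype.card, ← Finset.sum_const, ← Finset.sum_add_distrib]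
    exact Finset.sum_le_sum fun τ _ => hHun τ.1 τ.2.1 τ.2.2.1 τ.2.2.2
  have hdef : ∑ x, (ℓ x - (H.graph.neighborSet x).ncard) ≤ U + okᶜ.ncard * M := by
    have h1 : ∀ x, ℓ x - (H.graph.neighborSet x).ncard ≤
        ∑ c, (D x c - H.nbrCount β x c) + if x ∈ okᶜ then M else 0 := by
      intro x
      by_cases hx : x ∈ ok
      · rw [if_neg (by simpa using hx), add_zero, hHdeg, ← hDok x hx,
          ← Finset.sum_tsub_distrib _ fun c _ => hHD x c]
      · rw [if_pos (by simpa using hx)]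
        exact (Nat.sub_le _ _).trans ((hℓ x).trans (Nat.le_add_left _ _))
    refine (Finset.sum_le_sum fun x _ => h1 x).trans ?_
    rw [Finset.sum_add_distrib, ← Finset.sum_filter, Finset.sum_const, smul_eq_mul,
      Set.ncard_eq_toFinset_card']
    refine add_le_add le_rfl (Nat.mul_le_mul_right _ (Finset.card_le_card fun x hx => ?_))
    simpa using hx
  let Γ : MarkedGraph V Θ Ξ :=
    { graph := G
      vertexMark := fun x => (γ x).mark
      edgeMark := fun x y _ => if h : H.graph.Adj x y then H.edgeMark x y h else
        Classical.arbitrary Ξ }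
  -- the vertices at which nothing went wrong
  set F : Set V := {x | G.neighborSet x = H.graph.neighborSet x ∧ x ∈ ok ∧
    ∀ c, H.nbrCount β x c = D x c} with hF
  have hFc : Fᶜ.ncard ≤ 3 * U + (2 * M + 2) * (M + 1) + (2 * M + 1) * okᶜ.ncard := by
    have hsub : Fᶜ ⊆ {x | G.neighborSet x ≠ H.graph.neighborSet x} ∪ okᶜ ∪
        {x | 0 < ∑ c, (D x c - H.nbrCount β x c)} := by
      intro x hx
      by_contra hx'
      simp only [Set.mem_union, Set.mem_ofPred_eq, Set.mem_compl_iff, not_or, not_not] at hx'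
      refine hx ⟨hx'.1.1, hx'.1.2, fun c => ?_⟩
      have h1 := hx'.2
      rw [not_lt, Nat.le_zero, Finset.sum_eq_zero_iff] at h1
      have h2 := h1 c (Finset.mem_univ c)
      have h3 := hHD x c
      omega
    have h1 := Set.ncard_le_ncard hsub (Set.toFinite _)
    have h2 := Set.ncard_union_le ({x | G.neighborSet x ≠ H.graph.neighborSet x} ∪ okᶜ)
      {x | 0 < ∑ c, (D x c - H.nbrCount β x c)}
    have h3 := Set.ncard_union_le {x | G.neighborSet x ≠ H.graph.neighborSet x} okᶜ
    have h4 : {x | 0 < ∑ c, (D x c - H.nbrCount β x c)}.ncard ≤ U := by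
      rw [Set.ncard_eq_toFinset_card', Finset.card_eq_sum_ones]
      refine (Finset.sum_le_sum fun z hz => ?_).trans
        (Finset.sum_le_sum_of_subset (Finset.subset_univ _))
      simp only [Set.mem_toFinset, Set.mem_ofPred_eq] at hz
      exact hz
    nlinarith
  have hgood : ∀ x, (∀ y (p : G.Walk x y), p.length ≤ j + 1 → y ∈ F) →
      (Γ.component x).TreeLike (j + 1) ∧ Γ.code W (j + 1) x = γ x := by
    intro x hx
    constructor
    · refine Γ.treeLike_component hHcycle le_rfl x fun y p hp z hz => ?_
      have h1 : z ∈ G.neighborSet y := hz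
      rw [(hx y p hp).1] at h1
      exact h1
    · refine Γ.code_eq_of_forall_nbrCount γ (fun _ => rfl) F (fun y hy => ?_) x
        fun y p hp => hx y p (by omega)
      refine ⟨(hok y hy.2.1).1, fun c => ?_⟩
      have h1 := hy.2.2 c
      rw [hD] at h1
      simp only [if_pos hy.2.1] at h1
      rw [← h1]
      have hadj : ∀ z, G.Adj y z ↔ H.graph.Adj y z := fun z => by
        have : z ∈ G.neighborSet y ↔ z ∈ H.graph.neighborSet y := by rw [hy.1]
        exact this
      obtain ⟨ξ, ξ', b⟩ := c
      rw [nbrCount_eq_ncard, nbrCount_eq_ncard]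
      congr 1
      ext z
      simp only [Set.mem_ofPred_eq]
      refine and_congr_left fun _ => ⟨?_, ?_⟩
      · rintro ⟨h, h2, h3⟩
        have h' := (hadj z).1 h
        exact ⟨h', by rw [← h2]; exact (dif_pos h').symm,
          by rw [← h3]; exact (dif_pos h'.symm).symm⟩
      · rintro ⟨h', h2, h3⟩
        exact ⟨(hadj z).2 h', by rw [← h2]; exact dif_pos h', by rw [← h3]; exact dif_pos h'.symm⟩
  refine ⟨Γ, hGdeg, ?_⟩
  have hsub : {x | ¬ ((Γ.component x).TreeLike (j + 1) ∧ Γ.code W (j + 1) x = γ x)} ⊆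
      ⋃ y ∈ Fᶜ, {x | ∃ p : G.Walk y x, p.length ≤ j + 1} := by
    intro x hx
    rw [Set.mem_iUnion₂]
    by_contra hcon
    refine hx (hgood x fun y p hp => ?_)
    by_contra hy
    exact hcon ⟨y, hy, p.reverse, by rwa [SimpleGraph.Walk.length_reverse]⟩
  refine (Set.ncard_le_ncard hsub (Set.toFinite _)).trans ?_
  refine (Set.ncard_biUnion_le_mul _ _ ((M + 1) ^ (j + 1)) fun y _ =>
    SimpleGraph.ncard_walk_length_le (fun z => (hGdeg z).trans_le (hℓ z)) y (j + 1)).trans ?_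
  rw [mul_right_comm]
  refine Nat.mul_le_mul_right _ ?_
  set Q := (2 * M + 2) * (M + 1)
  set Z := okᶜ.ncard
  calc Fᶜ.ncard ≤ 3 * (T * C + E) + Q + (2 * M + 1) * Z := by omega
    _ ≤ (3 * (T * C) + Q + 3 + 2 * M + 1) * (1 + Z + E) := by
      have e1 : (3 * (T * C) + Q + 3 + 2 * M + 1) * (1 + Z + E) =
        (3 * (T * C + E) + Q + (2 * M + 1) * Z) + ((3 * (T * C) + Q + 3) * Z +
          (3 * (T * C) + Q + 2 * M + 1) * E + (3 + 2 * M + 1)) := by ring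
      rw [e1]
      exact Nat.le_add_right _ _

end MarkedGraph

/-! ### Unimodularity balances the half-edges of opposite kinds -/

instance (Θ : Type u) (Ξ : Type v) (W j : ℕ) : MeasurableSpace (Code Θ Ξ W j) := ⊤

instance (Θ : Type u) (Ξ : Type v) (W j : ℕ) : DiscreteMeasurableSpace (Code Θ Ξ W j) :=
  ⟨fun _ => trivial⟩

namespace MarkedGraph

variable {V V' : Type} {Θ Θ' : Type u} {Ξ : Type v}

/-- Apply a map to the vertex marks. -/
def mapMark (f : Θ → Θ') (G : MarkedGraph V Θ Ξ) : MarkedGraph V Θ' Ξ where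
  graph := G.graph
  vertexMark x := f (G.vertexMark x)
  edgeMark := G.edgeMark

theorem LocalIso.mapMark {G : MarkedGraph V Θ Ξ} {G' : MarkedGraph V' Θ Ξ} {φ : V → V'}
    {δ : V → ℕ} {r : ℕ} (h : LocalIso G G' φ δ r) (f : Θ → Θ') :
    LocalIso (G.mapMark f) (G'.mapMark f) φ δ r :=
  ⟨fun x => congrArg f (h.mark x), h.bij, h.edge, h.step⟩

end MarkedGraph

namespace PreRooted

variable {Θ : Type u} {Ξ : Type v}

/-- In a doubly rooted graph, the first root has colour `a` and the second root is a neighbour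
of kind `c` of the first root. -/
def EdgeKind (W j : ℕ) (a : Code Θ Ξ W j) (c : Ξ × Ξ × Code Θ Ξ W j)
    (A : PreRooted (Θ × Bool) Ξ) : Prop :=
  (A.G.mapMark Prod.fst).code W j A.root = a ∧
    ∃ y : (A.G.mapMark Prod.fst).graph.neighborSet A.root, (A.G.vertexMark y).2 = true ∧
      (A.G.mapMark Prod.fst).nbrType ((A.G.mapMark Prod.fst).code W j) A.root y = c

theorem edgeKind_iff_of_localIso {W j : ℕ} {a : Code Θ Ξ W j} {c : Ξ × Ξ × Code Θ Ξ W j}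
    {A B : PreRooted (Θ × Bool) Ξ} {φ : A.V → B.V} {δ : A.V → ℕ} (h0 : φ A.root = B.root)
    (h : MarkedGraph.LocalIso A.G B.G φ δ (j + 1)) (hδ : δ A.root = 0) :
    EdgeKind W j a c A ↔ EdgeKind W j a c B := by
  have hm := h.mapMark Prod.fst
  have hcode := hm.code_eq W j
  have hb := h.bij A.root (by omega)
  have htype : ∀ (y : (A.G.mapMark Prod.fst).graph.neighborSet A.root)
      (y' : (B.G.mapMark Prod.fst).graph.neighborSet (φ A.root)), (y' : B.V) = φ y →
      (B.G.mapMark Prod.fst).nbrType ((B.G.mapMark Prod.fst).code W j) (φ A.root) y' =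
      (A.G.mapMark Prod.fst).nbrType ((A.G.mapMark Prod.fst).code W j) A.root y := by
    intro y y' hy
    refine hm.nbrType_eq y y' hy (hcode y ?_)
    have := h.step A.root y y.2
    omega
  rw [EdgeKind, EdgeKind, ← h0, hcode A.root (by omega)]
  refine and_congr_right fun _ => ⟨?_, ?_⟩
  · rintro ⟨y, h1, h2⟩
    refine ⟨⟨φ y, hb.mapsTo y.2⟩, ?_, ?_⟩
    · rw [← h1]
      exact congrArg Prod.snd (h.mark y)
    · rw [← h2]
      exact htype _ _ rfl
  · rintro ⟨y', h1, h2⟩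
    obtain ⟨y, hy, hyy'⟩ := hb.surjOn y'.2
    refine ⟨⟨y, hy⟩, ?_, ?_⟩
    · rw [← h1, ← hyy']
      exact congrArg Prod.snd (h.mark y).symm
    · rw [← h2]
      exact (htype ⟨y, hy⟩ y' hyy'.symm).symm

theorem edgeKind_doublyRooted {W j : ℕ} {a : Code Θ Ξ W j} {c : Ξ × Ξ × Code Θ Ξ W j}
    (A : PreRooted Θ Ξ) (x y : A.V) : EdgeKind W j a c (A.doublyRooted x y) ↔
      A.G.code W j x = a ∧ ∃ h : A.G.graph.Adj x y, A.G.nbrType (A.G.code W j) x ⟨y, h⟩ = c := by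
  refine and_congr_right fun _ => ⟨?_, ?_⟩
  · rintro ⟨⟨z, hz⟩, h1, h2⟩
    have hzy : z = y := (@decide_eq_true_iff (z = y) (Classical.propDecidable _)).1 h1
    have h3 : ∀ z : A.V, z = y → ∀ h : A.G.graph.Adj x z,
        A.G.nbrType (A.G.code W j) x ⟨z, h⟩ = c →
        ∃ h : A.G.graph.Adj x y, A.G.nbrType (A.G.code W j) x ⟨y, h⟩ = c := by
      rintro z rfl h h'
      exact ⟨h, h'⟩
    exact h3 z hzy hz h2
  · rintro ⟨h, h2⟩
    exact ⟨⟨y, h⟩, (@decide_eq_true_iff (y = y) (Classical.propDecidable _)).2 rfl, h2⟩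

theorem edgeKind_swap {W j : ℕ} {a b : Code Θ Ξ W j} {ξ ξ' : Ξ}
    (A : PreRooted Θ Ξ) (x y : A.V) : EdgeKind W j a (ξ, ξ', b) (A.doublyRooted x y) ↔
      EdgeKind W j b (ξ', ξ, a) (A.doublyRooted y x) := by
  rw [edgeKind_doublyRooted, edgeKind_doublyRooted]
  simp only [MarkedGraph.nbrType, Prod.mk.injEq]
  constructor
  · rintro ⟨h1, h, h2, h3, h4⟩
    exact ⟨h4, h.symm, h3, h2, h1⟩
  · rintro ⟨h1, h, h2, h3, h4⟩
    exact ⟨h4, h.symm, h3, h2, h1⟩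

end PreRooted

namespace RootedGraphs

variable {Θ : Type u} {Ξ : Type v}

theorem measurableSet_of_trunc (r : ℕ) {S : Set (RootedGraphs Θ Ξ)}
    (h : ∀ g, trunc r g ∈ S ↔ g ∈ S) : MeasurableSet S := by
  classical
  have h1 := (continuous_comp_trunc r fun g : RootedGraphs Θ Ξ => decide (g ∈ S)).isOpen_preimage
    {true} (isOpen_discrete _)
  convert h1.measurableSet
  ext g
  simp [h]

/-- The colour of the root. -/
noncomputable def code (W j : ℕ) : RootedGraphs Θ Ξ → Code Θ Ξ W j :=
  Quotient.lift (fun A => A.G.code W j A.root) fun A B h => by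
    obtain ⟨φ, h0, h1⟩ := PreRooted.Iso.exists_localIso h j
    show A.G.code W j A.root = B.G.code W j B.root
    rw [← h0, h1.code_eq W j A.root (by omega)]

theorem code_trunc (W j : ℕ) (g : RootedGraphs Θ Ξ) : code W j (trunc j g) = code W j g := by
  induction g using Quotient.inductionOn with
  | h A =>
    exact ((A.localIso_trunc j).code_eq W j (A.trunc j).root (by
      show A.G.graph.dist A.root A.root + j ≤ j
      rw [SimpleGraph.dist_self]; omega)).symm

theorem measurable_code (W j : ℕ) : Measurable (code W j : RootedGraphs Θ Ξ → Code Θ Ξ W j) :=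
  fun S _ => measurableSet_of_trunc j fun g => by
    rw [Set.mem_preimage, Set.mem_preimage, code_trunc]

theorem rootDegree_trunc (A : PreRooted Θ Ξ) :
    rootDegree (unmark (trunc 1 (mk A))) = A.G.degree A.root := by
  refine ((A.localIso_trunc 1).degree_eq (A.trunc 1).root ?_).symm
  show A.G.graph.dist A.root A.root < 1
  rw [SimpleGraph.dist_self]; omega

/-- The doubly rooted graphs in which the first root has colour `a` and the second root is a
neighbour of kind `c` of the first root. -/
def edgeKindSet (W j : ℕ) (a : Code Θ Ξ W j) (c : Ξ × Ξ × Code Θ Ξ W j) :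
    Set (RootedGraphs (Θ × Bool) Ξ) :=
  {g | Quotient.lift (PreRooted.EdgeKind W j a c) (fun _ _ h => by
    obtain ⟨φ, h0, h1⟩ := PreRooted.Iso.exists_localIso h (j + 1)
    exact propext (PreRooted.edgeKind_iff_of_localIso h0 h1 rfl)) g}

theorem measurableSet_edgeKindSet (W j : ℕ) (a : Code Θ Ξ W j) (c : Ξ × Ξ × Code Θ Ξ W j) :
    MeasurableSet (edgeKindSet W j a c) :=
  measurableSet_of_trunc (j + 1) fun g => by
    induction g using Quotient.inductionOn with
    | h A =>
      refine PreRooted.edgeKind_iff_of_localIso (A := A.trunc (j + 1)) (B := A) rfl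
        (A.localIso_trunc (j + 1)) ?_
      exact SimpleGraph.dist_self

open Classical in
theorem massOut_edgeKindSet {W j : ℕ} (a : Code Θ Ξ W j) (c : Ξ × Ξ × Code Θ Ξ W j)
    (A : PreRooted Θ Ξ) :
    massOut ((edgeKindSet W j a c).indicator 1) (mk A) =
      if A.G.code W j A.root = a then (A.G.nbrCount (A.G.code W j) A.root c : ℝ≥0∞) else 0 := by
  obtain ⟨ξ, ξ', b⟩ := c
  have hmem : ∀ x, mk (A.doublyRooted A.root x) ∈ edgeKindSet W j a (ξ, ξ', b) ↔
      A.G.code W j A.root = a ∧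
        ∃ h : A.G.graph.Adj A.root x,
          A.G.nbrType (A.G.code W j) A.root ⟨x, h⟩ = (ξ, ξ', b) :=
    fun x => A.edgeKind_doublyRooted A.root x
  show ∑' x : A.V, (edgeKindSet W j a (ξ, ξ', b)).indicator 1 (mk (A.doublyRooted A.root x)) = _
  split_ifs with ha
  · rw [MarkedGraph.nbrCount_eq_ncard]
    set S := {y | (∃ h : A.G.graph.Adj A.root y, A.G.edgeMark A.root y h = ξ ∧
      A.G.edgeMark y A.root h.symm = ξ') ∧ A.G.code W j y = b} with hS
    have hfin : S.Finite := (A.locallyFinite A.root).subset fun y hy => hy.1.1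
    have h1 : ∀ x, (edgeKindSet W j a (ξ, ξ', b)).indicator (1 : RootedGraphs (Θ × Bool) Ξ → ℝ≥0∞)
        (mk (A.doublyRooted A.root x)) = S.indicator (fun _ => (1 : ℝ≥0∞)) x := by
      intro x
      have h2 : mk (A.doublyRooted A.root x) ∈ edgeKindSet W j a (ξ, ξ', b) ↔ x ∈ S := by
        rw [hmem, hS]
        simp only [ha, true_and, MarkedGraph.nbrType, Prod.mk.injEq, Set.mem_ofPred_eq]
        constructor
        · rintro ⟨h, h1, h2, h3⟩
          exact ⟨⟨h, h1, h2⟩, h3⟩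
        · rintro ⟨⟨h, h1, h2⟩, h3⟩
          exact ⟨h, h1, h2, h3⟩
      by_cases hx : x ∈ S
      · rw [Set.indicator_of_mem (h2.2 hx), Set.indicator_of_mem hx]; rfl
      · rw [Set.indicator_of_notMem (fun h => hx (h2.1 h)), Set.indicator_of_notMem hx]
    rw [tsum_congr h1, ← tsum_subtype S fun _ => (1 : ℝ≥0∞), ENNReal.tsum_set_one,
      ← hfin.cast_ncard_eq]
    simp
  · refine ENNReal.tsum_eq_zero.2 fun x => Set.indicator_of_notMem (fun h => ha ?_) _
    exact ((hmem x).1 h).1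

theorem massIn_edgeKindSet {W j : ℕ} (a b : Code Θ Ξ W j) (ξ ξ' : Ξ) (g : RootedGraphs Θ Ξ) :
    massIn ((edgeKindSet W j a (ξ, ξ', b)).indicator 1) g =
      massOut ((edgeKindSet W j b (ξ', ξ, a)).indicator 1) g := by
  induction g using Quotient.inductionOn with
  | h A =>
    refine tsum_congr fun x => ?_
    have h : mk (A.doublyRooted x A.root) ∈ edgeKindSet W j a (ξ, ξ', b) ↔
        mk (A.doublyRooted A.root x) ∈ edgeKindSet W j b (ξ', ξ, a) :=
      A.edgeKind_swap x A.root
    by_cases hx : mk (A.doublyRooted x A.root) ∈ edgeKindSet W j a (ξ, ξ', b)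
    · rw [Set.indicator_of_mem hx, Set.indicator_of_mem (h.1 hx)]; rfl
    · rw [Set.indicator_of_notMem hx, Set.indicator_of_notMem fun h' => hx (h.2 h')]

open Classical in
/-- The expected number of half-edges with marks `ξ, ξ'` from a root of colour `a` to a neighbour
of colour `b` is the same as that of the half-edges of the opposite kind: this is the mass
transport principle. -/
theorem IsUnimodular.sum_code_eq [Finite Θ] [Finite Ξ] {W j : ℕ} [Fintype (Code Θ Ξ W (j + 1))]
    {ρ : ProbabilityMeasure (RootedGraphs Θ Ξ)} (hρ : IsUnimodular ρ)
    (hW : ∀ᵐ g ∂(ρ : Measure (RootedGraphs Θ Ξ)), ∃ A, mk A = g ∧ ∀ x, A.G.degree x ≤ W)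
    (a b : Code Θ Ξ W j) (ξ ξ' : Ξ) :
    ∑ s : Code Θ Ξ W (j + 1), (ρ : Measure (RootedGraphs Θ Ξ)).real (code W (j + 1) ⁻¹' {s}) *
        (if s.1 = a then ((s.2 (ξ, ξ', b) : ℕ) : ℝ) else 0) =
      ∑ s : Code Θ Ξ W (j + 1), (ρ : Measure (RootedGraphs Θ Ξ)).real (code W (j + 1) ⁻¹' {s}) *
        (if s.1 = b then ((s.2 (ξ', ξ, a) : ℕ) : ℝ) else 0) := by
  have hout : ∀ (a b : Code Θ Ξ W j) (ξ ξ' : Ξ),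
      ∫⁻ g, massOut ((edgeKindSet W j a (ξ, ξ', b)).indicator 1) g
        ∂(ρ : Measure (RootedGraphs Θ Ξ)) =
      ENNReal.ofReal (∑ s : Code Θ Ξ W (j + 1),
        (ρ : Measure (RootedGraphs Θ Ξ)).real (code W (j + 1) ⁻¹' {s}) *
          (if s.1 = a then ((s.2 (ξ, ξ', b) : ℕ) : ℝ) else 0)) := by
    intro a b ξ ξ'
    let F : Code Θ Ξ W (j + 1) → ℝ≥0∞ := fun s =>
      if s.1 = a then ((s.2 (ξ, ξ', b) : ℕ) : ℝ≥0∞) else 0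
    have h1 : ∫⁻ g, massOut ((edgeKindSet W j a (ξ, ξ', b)).indicator 1) g
        ∂(ρ : Measure (RootedGraphs Θ Ξ)) =
        ∫⁻ g, F (code W (j + 1) g) ∂(ρ : Measure (RootedGraphs Θ Ξ)) := by
      refine lintegral_congr_ae ?_
      filter_upwards [hW] with g hg
      obtain ⟨A, rfl, hA⟩ := hg
      rw [massOut_edgeKindSet,
        ← MarkedGraph.code_succ_snd A.G W j A.root (A.locallyFinite _) (hA _)]
      rfl
    rw [h1, ← lintegral_map (Measurable.of_discrete (f := F)) (measurable_code W (j + 1)),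
      lintegral_fintype, ENNReal.ofReal_sum_of_nonneg fun s _ => mul_nonneg measureReal_nonneg (by
        split_ifs <;> positivity)]
    refine Finset.sum_congr rfl fun s _ => ?_
    rw [Measure.map_apply (measurable_code W (j + 1)) (measurableSet_singleton s),
      ENNReal.ofReal_mul measureReal_nonneg, Measure.real, ENNReal.ofReal_toReal
        (measure_ne_top _ _), mul_comm]
    congr 1
    simp only [F]
    split_ifs <;> simp
  have h := hρ _ (measurable_one.indicator (measurableSet_edgeKindSet W j a (ξ, ξ', b)))
  simp_rw [massIn_edgeKindSet] at h
  rw [hout, hout] at h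
  have hnn : ∀ (a b : Code Θ Ξ W j) (ξ ξ' : Ξ), 0 ≤ ∑ s : Code Θ Ξ W (j + 1),
        (ρ : Measure (RootedGraphs Θ Ξ)).real (code W (j + 1) ⁻¹' {s}) *
          (if s.1 = a then ((s.2 (ξ, ξ', b) : ℕ) : ℝ) else 0) := fun a b ξ ξ' =>
    Finset.sum_nonneg fun s _ => mul_nonneg measureReal_nonneg (by split_ifs <;> positivity)
  exact (ENNReal.ofReal_eq_ofReal_iff (hnn _ _ _ _) (hnn _ _ _ _)).1 h

end RootedGraphs

/-! ### Distributing the colours among the vertices -/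

theorem tendsto_one_div_pnat : Tendsto (fun n : ℕ+ => (1 : ℝ) / n) atTop (𝓝 0) :=
  (tendsto_one_div_atTop_nhds_zero_nat (𝕜 := ℝ)).comp tendsto_PNat_val_atTop_atTop

theorem exists_map_card_fiber_ge {ι S : Type*} [Fintype S] [Nonempty S] [DecidableEq S]
    (I : Finset ι) (a : S → ℕ) (h : ∑ s, a s ≤ I.card) :
    ∃ f : ι → S, ∀ s, a s ≤ (I.filter fun i => f i = s).card := by
  classical
  have hc : Fintype.card (Σ s, Fin (a s)) ≤ Fintype.card I := by
    simpa using h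
  obtain ⟨e⟩ := Function.Embedding.nonempty_of_card_le hc
  refine ⟨fun i => if h : ∃ p, (e p : ι) = i then h.choose.1 else Classical.arbitrary S,
    fun s => ?_⟩
  have hval : ∀ p, (if h : ∃ q, (e q : ι) = e p then h.choose.1 else Classical.arbitrary S) =
      p.1 := by
    intro p
    have h : ∃ q, (e q : ι) = e p := ⟨p, rfl⟩
    rw [dif_pos h, e.injective (Subtype.ext h.choose_spec)]
  have h1 : (Finset.univ : Finset (Fin (a s))).card ≤
      (I.filter fun i => (if h : ∃ p, (e p : ι) = i then h.choose.1 else Classical.arbitrary S)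
        = s).card := by
    refine Finset.card_le_card_of_injOn (fun x => (e ⟨s, x⟩ : ι)) (fun x _ => ?_) ?_
    · rw [Finset.coe_filter]
      exact ⟨(e ⟨s, x⟩).2, hval _⟩
    · intro x _ y _ hxy
      have := e.injective (Subtype.ext hxy)
      simpa using this
  simpa using h1

/-- Given a vertex-degree sequence whose degree distributions converge to the image of `q` under
`deg`, the vertices can be coloured so that the colours are compatible with the degrees, up to
a negligible proportion of the vertices, and asymptotically have distribution `q`. -/
theorem exists_assignment {S : Type*} [Fintype S] [DecidableEq S] (deg : S → ℕ) (q : S → ℝ)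
    (hq0 : ∀ s, 0 ≤ q s) (hq1 : ∑ s, q s = 1) (ℓ : ∀ n : ℕ+, Fin n → ℕ)
    (hℓ : ∀ d, Tendsto (fun n : ℕ+ => ((Finset.univ.filter fun i => ℓ n i = d).card : ℝ) / n) atTop
      (𝓝 (∑ s with deg s = d, q s))) :
    ∃ γ : ∀ n : ℕ+, Fin n → S, ∀ G : S → ℝ,
      Tendsto (fun n : ℕ+ => (∑ i, if ℓ n i = deg (γ n i) then G (γ n i) else 0) / (n : ℝ)) atTop
        (𝓝 (∑ s, q s * G s)) := by
  have hne : Nonempty S := by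
    by_contra h
    rw [not_nonempty_iff] at h
    simp at hq1
  let N : ℕ+ → ℕ → ℕ := fun n d => (Finset.univ.filter fun i => ℓ n i = d).card
  let Q : ℕ → ℝ := fun d => ∑ s with deg s = d, q s
  have hQ0 : ∀ d, 0 ≤ Q d := fun d => Finset.sum_nonneg fun s _ => hq0 s
  have hqQ : ∀ s, q s ≤ Q (deg s) := fun s =>
    Finset.single_le_sum (fun t _ => hq0 t) (by simp)
  -- among the vertices of degree `d`, use each colour `s` in proportion to `q s`
  have hex : ∀ (n : ℕ+) (d : ℕ), ∃ f : Fin n → S, ∀ s, deg s = d →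
      ⌊q s * N n d / Q d⌋₊ ≤ ((Finset.univ.filter fun i => ℓ n i = d).filter fun i =>
        f i = s).card := by
    intro n d
    obtain ⟨f, hf⟩ := exists_map_card_fiber_ge (Finset.univ.filter fun i => ℓ n i = d)
      (fun s => if deg s = d then ⌊q s * N n d / Q d⌋₊ else 0) (by
        rw [← Finset.sum_filter, ← Nat.cast_le (α := ℝ), Nat.cast_sum]
        refine (Finset.sum_le_sum fun s _ => Nat.floor_le
          (div_nonneg (mul_nonneg (hq0 s) (Nat.cast_nonneg _)) (hQ0 d))).trans ?_
        rw [← Finset.sum_div, ← Finset.sum_mul]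
        rcases (hQ0 d).eq_or_lt with h | h
        · rw [← h, div_zero]; exact Nat.cast_nonneg _
        · rw [div_le_iff₀ h, mul_comm])
    exact ⟨f, fun s hs => by simpa [hs] using hf s⟩
  choose f hf using hex
  let γ : ∀ n : ℕ+, Fin n → S := fun n i => f n (ℓ n i) i
  let X : S → ℕ+ → ℝ := fun s n =>
    ((Finset.univ.filter fun i => ℓ n i = deg (γ n i) ∧ γ n i = s).card : ℝ) / n
  have hn0 : ∀ n : ℕ+, (0 : ℝ) < n := fun n => Nat.cast_pos.2 n.pos
  let Y : S → ℕ+ → ℝ := fun s n =>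
    if Q (deg s) = 0 then 0 else q s * ((N n (deg s) : ℝ) / n) / Q (deg s) - 1 / n
  have hYlim : ∀ s, Tendsto (Y s) atTop (𝓝 (q s)) := by
    intro s
    by_cases h : Q (deg s) = 0
    · have h1 : q s = 0 := le_antisymm (h ▸ hqQ s) (hq0 s)
      simp only [Y, h, if_true, h1]
      exact tendsto_const_nhds
    · simp only [Y, h, if_false]
      have h1 := ((((hℓ (deg s)).const_mul (q s)).div_const (Q (deg s))).sub tendsto_one_div_pnat)
      rwa [sub_zero, mul_div_assoc, div_self h, mul_one] at h1
  have hYX : ∀ s n, Y s n ≤ X s n := by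
    intro s n
    by_cases h : Q (deg s) = 0
    · simp only [Y, h, if_true]
      exact div_nonneg (Nat.cast_nonneg _) (hn0 n).le
    · simp only [Y, h, if_false, X]
      rw [mul_div_assoc', div_right_comm, ← sub_div]
      refine div_le_div_of_nonneg_right ?_ (hn0 n).le
      have h1 := (Nat.lt_floor_add_one (q s * N n (deg s) / Q (deg s)))
      have h2 : ((Finset.univ.filter fun i => ℓ n i = deg s).filter fun i =>
          f n (deg s) i = s).card ≤
          (Finset.univ.filter fun i => ℓ n i = deg (γ n i) ∧ γ n i = s).card := by
        refine Finset.card_le_card fun i hi => ?_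
        simp only [Finset.mem_filter, Finset.mem_univ, true_and] at hi ⊢
        have h3 : γ n i = s := by
          show f n (ℓ n i) i = s
          rw [hi.1, hi.2]
        exact ⟨by rw [h3, hi.1], h3⟩
      have h3 : ((⌊q s * N n (deg s) / Q (deg s)⌋₊ : ℕ) : ℝ) ≤ _ :=
        Nat.cast_le.2 ((hf n (deg s) s rfl).trans h2)
      linarith
  have hsumle : ∀ n, ∑ s, X s n ≤ 1 := by
    intro n
    rw [← Finset.sum_div, div_le_one (hn0 n), ← Nat.cast_sum, Nat.cast_le]
    have h1 := Finset.card_eq_sum_card_fiberwise (f := γ n) (t := Finset.univ)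
      (s := Finset.univ.filter fun i => ℓ n i = deg (γ n i)) (fun _ _ => Finset.mem_univ _)
    simp_rw [Finset.filter_filter] at h1
    rw [← h1]
    exact (Finset.card_le_univ _).trans_eq (by simp)
  have hX : ∀ s, Tendsto (X s) atTop (𝓝 (q s)) := by
    intro s
    -- lower bounds for all colours imply upper bounds, since the proportions add up to at most one
    have h1 : Tendsto (fun n => 1 - ∑ t ∈ Finset.univ.erase s, Y t n) atTop (𝓝 (q s)) := by
      have h2 := (tendsto_finsetSum (Finset.univ.erase s) fun t _ => hYlim t).const_sub 1
      have h3 : 1 - ∑ t ∈ Finset.univ.erase s, q t = q s := by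
        rw [← hq1, ← Finset.add_sum_erase _ _ (Finset.mem_univ s)]; ring
      rwa [h3] at h2
    refine tendsto_of_tendsto_of_tendsto_of_le_of_le (hYlim s) h1 (hYX s) fun n => ?_
    have h2 := hsumle n
    rw [← Finset.add_sum_erase _ _ (Finset.mem_univ s)] at h2
    have h3 := Finset.sum_le_sum fun t (_ : t ∈ Finset.univ.erase s) => hYX t n
    show X s n ≤ 1 - ∑ t ∈ Finset.univ.erase s, Y t n
    linarith
  refine ⟨γ, fun G => ?_⟩
  have h1 : ∀ n : ℕ+, (∑ i, if ℓ n i = deg (γ n i) then G (γ n i) else 0) / (n : ℝ) =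
      ∑ s, X s n * G s := by
    intro n
    rw [← Finset.sum_filter, ← Finset.sum_fiberwise_of_maps_to (g := γ n) (t := Finset.univ)
      (fun _ _ => Finset.mem_univ _), Finset.sum_div]
    refine Finset.sum_congr rfl fun s _ => ?_
    rw [Finset.filter_filter, Finset.sum_congr rfl (g := fun _ => G s) (by
      intro i hi
      rw [(Finset.mem_filter.1 hi).2.2]), Finset.sum_const, nsmul_eq_mul]
    simp only [X]
    ring
  simp_rw [h1]
  exact tendsto_finsetSum _ fun s _ => (hX s).mul_const _

/-! ### Empirical measures -/

section EmpiricalMeasure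

variable {V : Type} [Fintype V] [Nonempty V] {X : Type*} [MeasurableSpace X]

theorem empiricalMeasure_map {Y : Type*} [MeasurableSpace Y] (a : V → X) {f : X → Y}
    (hf : Measurable f) :
    (empiricalMeasure a).map (f := f) hf.aemeasurable = empiricalMeasure fun x => f (a x) := by
  refine Subtype.ext (Measure.ext fun S hS => ?_)
  show Measure.map f ((Fintype.card V : ℝ≥0∞)⁻¹ • ∑ x, Measure.dirac (a x)) S =
    ((Fintype.card V : ℝ≥0∞)⁻¹ • ∑ x, Measure.dirac (f (a x))) S
  rw [Measure.map_apply hf hS]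
  simp only [Measure.smul_apply, Measure.coe_finsetSum, Finset.sum_apply,
    Measure.dirac_apply' _ hS, Measure.dirac_apply' _ (hf hS)]
  rfl

theorem integral_empiricalMeasure (a : V → X) {f : X → ℝ} (hf : Measurable f) :
    ∫ x, f x ∂(empiricalMeasure a : Measure X) = (∑ x, f (a x)) / Fintype.card V := by
  show ∫ x, f x ∂((Fintype.card V : ℝ≥0∞)⁻¹ • ∑ x, Measure.dirac (a x)) = _
  rw [integral_smul_measure, integral_finsetSum_measure fun x _ =>
    integrable_dirac' hf.stronglyMeasurable (by simp)]
  simp_rw [integral_dirac' _ _ hf.stronglyMeasurable]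
  rw [ENNReal.toReal_inv, ENNReal.toReal_natCast, smul_eq_mul, div_eq_inv_mul]

end EmpiricalMeasure

theorem tendsto_card_fiber_div {ℓ : ∀ n : ℕ+, Fin n → ℕ} {P : ProbabilityMeasure ℕ}
    (hP : Tendsto (fun n : ℕ+ => empiricalMeasure (ℓ n)) atTop (𝓝 P)) (d : ℕ) :
    Tendsto (fun n : ℕ+ => ((Finset.univ.filter fun i => ℓ n i = d).card : ℝ) / n) atTop
      (𝓝 ((P : Measure ℕ).real {d})) := by
  have h := (ProbabilityMeasure.tendsto_iff_forall_integral_tendsto.1 hP)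
    (BoundedContinuousFunction.ofNormedAddCommGroup (fun i : ℕ => if i = d then (1 : ℝ) else 0)
      continuous_of_discreteTopology 1 fun i => by split_ifs <;> simp)
  simp only [BoundedContinuousFunction.coe_ofNormedAddCommGroup] at h
  have h1 : ∫ i, (if i = d then (1 : ℝ) else 0) ∂(P : Measure ℕ) = (P : Measure ℕ).real {d} := by
    rw [← integral_indicator_one (measurableSet_singleton d)]
    refine integral_congr_ae (Eventually.of_forall fun i => ?_)
    by_cases hi : i = d <;> simp [hi]
  rw [h1] at h
  refine h.congr fun n => ?_
  rw [integral_empiricalMeasure _ Measurable.of_discrete]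
  simp

namespace RootedGraphs

variable {Θ : Type u} {Ξ : Type v}

theorem integral_code [Finite Θ] [Finite Ξ] {W j : ℕ} [Fintype (Code Θ Ξ W j)]
    (ρ : ProbabilityMeasure (RootedGraphs Θ Ξ)) (F : Code Θ Ξ W j → ℝ) :
    ∫ g, F (code W j g) ∂(ρ : Measure (RootedGraphs Θ Ξ)) =
      ∑ s, (ρ : Measure (RootedGraphs Θ Ξ)).real (code W j ⁻¹' {s}) * F s := by
  rw [← integral_map (f := F) (measurable_code W j).aemeasurable
    (Measurable.of_discrete (f := F)).aestronglyMeasurable]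
  have := Measure.isProbabilityMeasure_map (μ := (ρ : Measure (RootedGraphs Θ Ξ)))
    (measurable_code (Θ := Θ) (Ξ := Ξ) W j).aemeasurable
  rw [integral_fintype (Integrable.of_finite)]
  refine Finset.sum_congr rfl fun s _ => ?_
  rw [map_measureReal_apply (measurable_code W j) (measurableSet_singleton s), smul_eq_mul]

theorem integral_truncLaw (k : ℕ) (ρ : ProbabilityMeasure (RootedGraphs Θ Ξ))
    (f : BoundedContinuousFunction (RootedGraphs Θ Ξ) ℝ) :
    ∫ g, f g ∂(truncLaw k ρ : Measure (RootedGraphs Θ Ξ)) =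
      ∫ g, f (trunc k g) ∂(ρ : Measure (RootedGraphs Θ Ξ)) :=
  integral_map (continuous_comp_trunc k id).measurable.aemeasurable
    f.continuous.measurable.aestronglyMeasurable

theorem depthOneLaw_neighbourhoodDistribution {V : Type} [Fintype V] [Nonempty V]
    (G : MarkedGraph V Θ Ξ) :
    depthOneLaw G.neighbourhoodDistribution = empiricalMeasure G.degree := by
  rw [depthOneLaw, MarkedGraph.neighbourhoodDistribution, empiricalMeasure_map _
    (continuous_comp_trunc 1 fun g => rootDegree (unmark g)).measurable]
  congr 1
  funext x
  rw [rootDegree_trunc]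
  exact ((G.localIso_component x 1).degree_eq (G.component x).root Nat.one_pos).symm

/-- The degree of the root has the law prescribed by the colour of the root. -/
theorem depthOneLaw_real_singleton [Finite Θ] [Fintype Ξ] {W j : ℕ} [Fintype (Code Θ Ξ W j)]
    [Fintype (Code Θ Ξ W (j + 1))] {ρ : ProbabilityMeasure (RootedGraphs Θ Ξ)}
    (hW : ∀ᵐ g ∂(ρ : Measure (RootedGraphs Θ Ξ)), ∃ A, mk A = g ∧ ∀ x, A.G.degree x ≤ W)
    (d : ℕ) : (depthOneLaw ρ : Measure ℕ).real {d} =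
      ∑ s : Code Θ Ξ W (j + 1) with s.deg = d,
        (ρ : Measure (RootedGraphs Θ Ξ)).real (code W (j + 1) ⁻¹' {s}) := by
  have hm := (continuous_comp_trunc 1 fun g : RootedGraphs Θ Ξ =>
    rootDegree (unmark g)).measurable
  have h1 := integral_code ρ fun s : Code Θ Ξ W (j + 1) => if s.deg = d then (1 : ℝ) else 0
  simp only [mul_ite, mul_one, mul_zero] at h1
  rw [Finset.sum_filter, ← h1]
  have h2 : (depthOneLaw ρ : Measure ℕ).real {d} = (ρ : Measure (RootedGraphs Θ Ξ)).real
      ((fun g => rootDegree (unmark (trunc 1 g))) ⁻¹' {d}) :=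
    map_measureReal_apply hm (measurableSet_singleton d)
  rw [h2, ← integral_indicator_one (hm (measurableSet_singleton d))]
  refine integral_congr_ae ?_
  filter_upwards [hW] with g hg
  obtain ⟨A, rfl, hA⟩ := hg
  have h3 : (code W (j + 1) (mk A)).deg = rootDegree (unmark (trunc 1 (mk A))) := by
    rw [rootDegree_trunc]
    exact A.G.deg_code A.root (A.locallyFinite _) (hA _)
  rw [h3]
  by_cases h : rootDegree (unmark (trunc 1 (mk A))) = d
  · rw [if_pos h, Set.indicator_of_mem (by exact h)]; rfl
  · rw [if_neg h, Set.indicator_of_notMem (by exact h)]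

/-- The colour of the root of a graph in the support of `ρ` is realized. -/
theorem measureReal_code_eq_zero {W j : ℕ} {ρ : ProbabilityMeasure (RootedGraphs Θ Ξ)}
    (hW : ∀ᵐ g ∂(ρ : Measure (RootedGraphs Θ Ξ)), ∃ A, mk A = g ∧ ∀ x, A.G.degree x ≤ W)
    {s : Code Θ Ξ W j} (hs : ¬ s.Realized) :
    (ρ : Measure (RootedGraphs Θ Ξ)).real (code W j ⁻¹' {s}) = 0 := by
  rw [Measure.real, ENNReal.toReal_eq_zero_iff]
  refine Or.inl (measure_mono_null (fun g hg => ?_) (ae_iff.1 hW))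
  rintro ⟨A, rfl, hA⟩
  exact hs ⟨A, hA, hg⟩

end RootedGraphs

/-! ### Convergence of the neighbourhood distributions -/

/-- On graphs with a tree-like ball around the root, functions of the truncation are functions
of the colour. -/
theorem PreRooted.exists_factor_code {Θ : Type u} {Ξ : Type v} (W k : ℕ)
    (f : RootedGraphs Θ Ξ → ℝ) {C : ℝ} (hC : 0 ≤ C) (hf : ∀ g, |f g| ≤ C) :
    ∃ F : Code Θ Ξ W k → ℝ, (∀ s, |F s| ≤ C) ∧ ∀ A : PreRooted Θ Ξ, A.TreeLike k →
      (∀ x, A.G.degree x ≤ W) →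
        f (RootedGraphs.trunc k (RootedGraphs.mk A)) = F (A.G.code W k A.root) := by
  classical
  refine ⟨fun s => if h : ∃ A : PreRooted Θ Ξ, A.TreeLike k ∧ (∀ x, A.G.degree x ≤ W) ∧
    A.G.code W k A.root = s then f (RootedGraphs.mk (h.choose.trunc k)) else 0, fun s => ?_,
    fun A tA hA => ?_⟩
  · dsimp only
    split_ifs with h
    · exact hf _
    · simpa using hC
  · have h : ∃ B : PreRooted Θ Ξ, B.TreeLike k ∧ (∀ x, B.G.degree x ≤ W) ∧
        B.G.code W k B.root = A.G.code W k A.root := ⟨A, tA, hA, rfl⟩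
    dsimp only
    rw [dif_pos h]
    obtain ⟨h1, h2, h3⟩ := h.choose_spec
    exact congrArg f (Quotient.sound (trunc_iso_of_code_eq hA h2 tA h1 h3.symm))

namespace RootedGraphs

variable {Θ : Type u} {Ξ : Type v}

/-- If most vertices of `Γ n` have a tree-like neighbourhood and the colour `γ n`, and the colours
`γ n` asymptotically have the law of the root colour under `ρ`, then the neighbourhood
distributions converge. Vertices for which `p` fails are disregarded. -/
theorem tendsto_truncLaw_neighbourhoodDistribution [Finite Θ] [Finite Ξ] {W k : ℕ}
    [Fintype (Code Θ Ξ W k)] {ρ : ProbabilityMeasure (RootedGraphs Θ Ξ)}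
    (hρ : ∀ᵐ g ∂(ρ : Measure (RootedGraphs Θ Ξ)),
      ∃ A, mk A = g ∧ A.G.graph.IsTree ∧ ∀ x, A.G.degree x ≤ W)
    (Γ : ∀ n : ℕ+, MarkedGraph (Fin n) Θ Ξ) (hΓ : ∀ n x, (Γ n).degree x ≤ W)
    (γ : ∀ n : ℕ+, Fin n → Code Θ Ξ W k) (p : ∀ n : ℕ+, Fin n → Prop)
    [∀ n x, Decidable (p n x)]
    (hγ : ∀ F : Code Θ Ξ W k → ℝ,
      Tendsto (fun n : ℕ+ => (∑ i, if p n i then F (γ n i) else 0) / (n : ℝ)) atTop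
        (𝓝 (∑ s, (ρ : Measure (RootedGraphs Θ Ξ)).real (code W k ⁻¹' {s}) * F s)))
    (hbad : Tendsto (fun n : ℕ+ =>
      (({x | ¬ (((Γ n).component x).TreeLike k ∧ (Γ n).code W k x = γ n x)}.ncard : ℕ) : ℝ) / n)
        atTop (𝓝 0))
    (hp : Tendsto (fun n : ℕ+ => (({x | ¬ p n x}.ncard : ℕ) : ℝ) / n) atTop (𝓝 0)) :
    Tendsto (fun n : ℕ+ => truncLaw k (Γ n).neighbourhoodDistribution) atTop
      (𝓝 (truncLaw k ρ)) := by
  classical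
  rw [ProbabilityMeasure.tendsto_iff_forall_integral_tendsto]
  intro f
  obtain ⟨F, hFle, hF⟩ := PreRooted.exists_factor_code W k f (norm_nonneg f)
    fun g => f.norm_coe_le_norm g
  have hlim : ∫ g, f g ∂(truncLaw k ρ : Measure (RootedGraphs Θ Ξ)) =
      ∑ s, (ρ : Measure (RootedGraphs Θ Ξ)).real (code W k ⁻¹' {s}) * F s := by
    rw [integral_truncLaw, ← integral_code]
    refine integral_congr_ae ?_
    filter_upwards [hρ] with g hg
    obtain ⟨A, rfl, hA, hAW⟩ := hg
    exact hF A (PreRooted.treeLike_of_isTree hA k) hAW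
  have hemp : ∀ n : ℕ+, ∫ g, f g
      ∂(truncLaw k (Γ n).neighbourhoodDistribution : Measure (RootedGraphs Θ Ξ)) =
      (∑ i, f (trunc k (mk ((Γ n).component i)))) / n := by
    intro n
    rw [integral_truncLaw, MarkedGraph.neighbourhoodDistribution, integral_empiricalMeasure
      (f := fun g => f (trunc k g)) _
      (f.continuous.measurable.comp (continuous_comp_trunc k id).measurable)]
    simp
  rw [hlim]
  simp_rw [hemp]
  have hdiff : Tendsto (fun n : ℕ+ => (∑ i, f (trunc k (mk ((Γ n).component i)))) / (n : ℝ) -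
      (∑ i, if p n i then F (γ n i) else 0) / (n : ℝ)) atTop (𝓝 0) := by
    have h0 := (hbad.add hp).const_mul (2 * ‖f‖)
    rw [add_zero, mul_zero] at h0
    refine squeeze_zero_norm (fun n => ?_) h0
    set b := {x | ¬ (((Γ n).component x).TreeLike k ∧ (Γ n).code W k x = γ n x)} with hb
    have hterm : ∀ i, |f (trunc k (mk ((Γ n).component i))) - if p n i then F (γ n i) else 0| ≤
        2 * ‖f‖ * ((if i ∈ b then 1 else 0) + if i ∈ {x | ¬ p n x} then 1 else 0) := by
      intro i
      have h1 : |f (trunc k (mk ((Γ n).component i))) - if p n i then F (γ n i) else 0| ≤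
          2 * ‖f‖ := by
        have h2 := f.norm_coe_le_norm (trunc k (mk ((Γ n).component i)))
        have h3 : |if p n i then F (γ n i) else 0| ≤ ‖f‖ := by
          split_ifs
          · exact hFle _
          · simp
        rw [Real.norm_eq_abs] at h2
        refine (abs_sub _ _).trans ?_
        linarith
      have h4 := norm_nonneg f
      by_cases hi : i ∈ b
      · refine h1.trans (le_mul_of_one_le_right (by positivity) ?_)
        rw [if_pos hi]
        split_ifs <;> norm_num
      · by_cases hi' : p n i
        · have h5 : ((Γ n).component i).TreeLike k ∧ (Γ n).code W k i = γ n i := by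
            by_contra h
            exact hi h
          have h6 := hF ((Γ n).component i) h5.1 fun x => by
            rw [← ((Γ n).localIso_component i 1).degree_eq x Nat.one_pos]
            exact hΓ n _
          have h7 := ((Γ n).localIso_component i k).code_eq W k ((Γ n).component i).root
            (by omega)
          have h8 : f (trunc k (mk ((Γ n).component i))) = F (γ n i) := by
            rw [h6, ← h7]
            exact congrArg F h5.2
          rw [h8, if_pos hi', sub_self, abs_zero]
          positivity
        · refine h1.trans (le_mul_of_one_le_right (by positivity) ?_)
          have : i ∈ {x | ¬ p n x} := hi'
          rw [if_pos this]
          split_ifs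
          norm_num
    rw [← sub_div, ← Finset.sum_sub_distrib, norm_div, Real.norm_eq_abs, Real.norm_natCast,
      ← add_div, mul_div_assoc']
    refine div_le_div_of_nonneg_right ?_ (Nat.cast_nonneg _)
    refine (Finset.abs_sum_le_sum_abs _ _).trans ((Finset.sum_le_sum fun i _ => hterm i).trans ?_)
    rw [← Finset.mul_sum, Finset.sum_add_distrib, Finset.sum_boole, Finset.sum_boole,
      Set.ncard_eq_toFinset_card' b, Set.ncard_eq_toFinset_card' {x | ¬ p n x}]
    refine mul_le_mul_of_nonneg_left (le_of_eq ?_) (by positivity)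
    congr 3 <;> ext i <;> simp
  have h := (hγ F).add hdiff
  rw [add_zero] at h
  refine h.congr fun n => ?_
  ring

end RootedGraphs

theorem mainTheorem3 {Θ : Type u} {Ξ : Type v} [Finite Θ] [Finite Ξ] [Nonempty Θ] [Nonempty Ξ]
    (ℓ : ∀ n : ℕ+, Fin n → ℕ)
    (hgraphical : ∀ n : ℕ+, ∃ G : SimpleGraph (Fin n), ∀ i, (G.neighborSet i).ncard = ℓ n i)
    (hbounded : ∃ M : ℕ, ∀ (n : ℕ+) (i : Fin n), ℓ n i ≤ M)
    (P : ProbabilityMeasure ℕ)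
    (hP : Tendsto (fun n : ℕ+ => empiricalMeasure (ℓ n)) atTop (𝓝 P))
    (k : ℕ) (hk : 1 < k) (L : ℕ)
    (ρ : ProbabilityMeasure (RootedGraphs Θ Ξ))
    (hunimodular : RootedGraphs.IsUnimodular ρ)
    (hsupp : ∀ᵐ g ∂(ρ : Measure (RootedGraphs Θ Ξ)), RootedGraphs.IsTreeWithDegreeLE L g)
    (hρP : RootedGraphs.depthOneLaw ρ = P) :
    ∃ Γ : ∀ n : ℕ+, MarkedGraph (Fin n) Θ Ξ,
      Tendsto (fun n : ℕ+ => RootedGraphs.truncLaw k (Γ n).neighbourhoodDistribution) atTop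
        (𝓝 (RootedGraphs.truncLaw k ρ)) ∧
      (∀ n : ℕ+, RootedGraphs.depthOneLaw (Γ n).neighbourhoodDistribution =
        empiricalMeasure (ℓ n)) ∧
      ∀ (n : ℕ+) (i : Fin n), (Γ n).degree i = ℓ n i := by
  classical
  have := Fintype.ofFinite Ξ
  obtain ⟨M, hM⟩ := hbounded
  obtain ⟨j, rfl⟩ : ∃ j, k = j + 1 := ⟨k - 1, by omega⟩
  set W := max M L with hWdef
  have := Fintype.ofFinite (Code Θ Ξ W j)
  have := Fintype.ofFinite (Code Θ Ξ W (j + 1))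
  have htree : ∀ᵐ g ∂(ρ : Measure (RootedGraphs Θ Ξ)),
      ∃ A, RootedGraphs.mk A = g ∧ A.G.graph.IsTree ∧ ∀ x, A.G.degree x ≤ W := by
    filter_upwards [hsupp] with g hg
    obtain ⟨A, h1, h2, h3⟩ := hg
    exact ⟨A, h1, h2, fun x => (h3 x).trans (le_max_right _ _)⟩
  have hdegW : ∀ᵐ g ∂(ρ : Measure (RootedGraphs Θ Ξ)),
      ∃ A, RootedGraphs.mk A = g ∧ ∀ x, A.G.degree x ≤ W := by
    filter_upwards [htree] with g hg
    obtain ⟨A, h1, -, h3⟩ := hg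
    exact ⟨A, h1, h3⟩
  -- the law of the colour of the root
  let q : Code Θ Ξ W (j + 1) → ℝ := fun s =>
    (ρ : Measure (RootedGraphs Θ Ξ)).real (RootedGraphs.code W (j + 1) ⁻¹' {s})
  have hq0 : ∀ s : Code Θ Ξ W (j + 1), ¬ s.Realized → q s = 0 := fun s hs =>
    RootedGraphs.measureReal_code_eq_zero hdegW hs
  have hq1 : ∑ s, q s = 1 := by
    have h := RootedGraphs.integral_code ρ fun _ : Code Θ Ξ W (j + 1) => (1 : ℝ)
    simp only [mul_one, integral_const, probReal_univ, smul_eq_mul] at h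
    exact h.symm
  obtain ⟨γ, hγ⟩ := exists_assignment Code.deg q (fun s => measureReal_nonneg) hq1 ℓ fun d => by
    have h := tendsto_card_fiber_div hP d
    rw [← hρP, RootedGraphs.depthOneLaw_real_singleton (j := j) hdegW d] at h
    exact h
  obtain ⟨ok, hmem⟩ : ∃ ok : ∀ n : ℕ+, Set (Fin n), ∀ n i, i ∈ ok n ↔
      (γ n i).Realized ∧ ℓ n i = (γ n i).deg :=
    ⟨fun n => {i | (γ n i).Realized ∧ ℓ n i = (γ n i).deg}, fun _ _ => Iff.rfl⟩
  have hok : Tendsto (fun n : ℕ+ => ((ok n)ᶜ.ncard : ℝ) / n) atTop (𝓝 0) := by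
    have h := (hγ fun s => if s.Realized then 1 else 0).const_sub 1
    have h1 : ∑ s, q s * (if s.Realized then 1 else 0) = 1 := by
      refine (Finset.sum_congr rfl fun s _ => ?_).trans hq1
      split_ifs with hs
      · rw [mul_one]
      · rw [hq0 s hs, mul_zero]
    rw [h1, sub_self] at h
    refine h.congr fun n => ?_
    have h2 := Set.ncard_add_ncard_compl (ok n)
    have h3 : (∑ i, if ℓ n i = (γ n i).deg then (if (γ n i).Realized then (1 : ℝ) else 0) else 0)
        = (ok n).ncard := by
      have h4 : (ok n).toFinset =
          Finset.univ.filter fun i => (γ n i).Realized ∧ ℓ n i = (γ n i).deg := by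
        ext i
        simp [hmem]
      rw [Set.ncard_eq_toFinset_card', h4, ← Finset.sum_boole]
      refine Finset.sum_congr rfl fun i _ => ?_
      by_cases h5 : ℓ n i = (γ n i).deg <;> simp [h5]
    rw [h3, eq_div_iff (Nat.cast_ne_zero.2 n.ne_zero), sub_mul, div_mul_cancel₀ _
      (Nat.cast_ne_zero.2 n.ne_zero), one_mul, sub_eq_iff_eq_add', ← Nat.cast_add, h2,
      Nat.card_eq_fintype_card, Fintype.card_fin]
  choose G₀ hG₀ using hgraphical
  obtain ⟨K, hK⟩ := MarkedGraph.exists_degree_eq_and_code_eq (Θ := Θ) (Ξ := Ξ) W j M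
  choose Γ hΓdeg hΓbad using fun n : ℕ+ => hK (Fin n) (ℓ n) (hM n) (G₀ n) (hG₀ n) (γ n) (ok n)
    fun x hx => (hmem n x).1 hx
  let N : ℕ+ → Code Θ Ξ W j → Ξ → Ξ → Code Θ Ξ W j → ℕ := fun n =>
    MarkedGraph.halfEdges (fun x => (γ n x).1) fun x c => if x ∈ ok n then ((γ n x).2 c : ℕ) else 0
  let e : Code Θ Ξ W j → Ξ → Ξ → Code Θ Ξ W j → ℝ := fun a ξ ξ' b =>
    ∑ s, q s * (if s.1 = a then ((s.2 (ξ, ξ', b) : ℕ) : ℝ) else 0)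
  have hN : ∀ a ξ ξ' b, Tendsto (fun n : ℕ+ => (N n a ξ ξ' b : ℝ) / n) atTop
      (𝓝 (e a ξ ξ' b)) := by
    intro a ξ ξ' b
    have h := hγ fun s => if s.Realized then (if s.1 = a then ((s.2 (ξ, ξ', b) : ℕ) : ℝ) else 0)
      else 0
    have h1 : ∑ s, q s * (if s.Realized then (if s.1 = a then ((s.2 (ξ, ξ', b) : ℕ) : ℝ) else 0)
      else 0) = e a ξ ξ' b := by
      refine Finset.sum_congr rfl fun s _ => ?_
      by_cases hs : s.Realized
      · rw [if_pos hs]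
      · rw [hq0 s hs, zero_mul, zero_mul]
    rw [h1] at h
    refine h.congr fun n => ?_
    simp only [N, MarkedGraph.halfEdges]
    rw [Finset.sum_filter, Nat.cast_sum]
    congr 1
    refine Finset.sum_congr rfl fun i _ => ?_
    by_cases h1 : ℓ n i = (γ n i).deg <;> by_cases h2 : (γ n i).Realized <;>
      by_cases h3 : (γ n i).1 = a <;> simp [h1, h2, h3, hmem]
  have hbal : ∀ a ξ ξ' b, Tendsto (fun n : ℕ+ =>
      ((N n a ξ ξ' b - N n b ξ' ξ a : ℕ) : ℝ) / n) atTop (𝓝 0) := by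
    intro a ξ ξ' b
    have h := ((hN a ξ ξ' b).sub (hN b ξ' ξ a)).abs
    rw [show e a ξ ξ' b = e b ξ' ξ a from hunimodular.sum_code_eq hdegW a b ξ ξ', sub_self,
      abs_zero] at h
    refine squeeze_zero (fun n => by positivity) (fun n => ?_) h
    rw [← sub_div, abs_div, Nat.abs_cast]
    refine div_le_div_of_nonneg_right ?_ (Nat.cast_nonneg _)
    rcases le_total (N n a ξ ξ' b) (N n b ξ' ξ a) with h1 | h1
    · rw [Nat.sub_eq_zero_of_le h1]
      simp
    · rw [Nat.cast_sub h1]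
      exact le_abs_self _
  refine ⟨Γ, ?_, fun n => ?_, hΓdeg⟩
  · refine RootedGraphs.tendsto_truncLaw_neighbourhoodDistribution htree Γ
      (fun n x => (hΓdeg n x).trans_le ((hM n x).trans (le_max_left _ _))) γ
      (fun n i => ℓ n i = (γ n i).deg) hγ ?_ ?_
    · have h := ((tendsto_one_div_pnat.add hok).add (tendsto_finsetSum Finset.univ
        fun (τ : Code Θ Ξ W j × Ξ × Ξ × Code Θ Ξ W j) _ =>
          hbal τ.1 τ.2.1 τ.2.2.1 τ.2.2.2)).const_mul (K : ℝ)
      simp only [Finset.sum_const_zero, add_zero, mul_zero] at h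
      refine squeeze_zero (fun n => by positivity) (fun n => ?_) h
      rw [← Finset.sum_div, ← add_div, ← add_div, mul_div_assoc']
      refine div_le_div_of_nonneg_right ?_ (Nat.cast_nonneg _)
      have h1 : _ ≤ K * (1 + (ok n)ᶜ.ncard + ∑ τ : Code Θ Ξ W j × Ξ × Ξ × Code Θ Ξ W j,
        (N n τ.1 τ.2.1 τ.2.2.1 τ.2.2.2 - N n τ.2.2.2 τ.2.2.1 τ.2.1 τ.1)) := hΓbad n
      exact_mod_cast h1
    · refine squeeze_zero (fun n => by positivity) (fun n => ?_) hok
      refine div_le_div_of_nonneg_right (Nat.cast_le.2 (Set.ncard_le_ncard (fun i hi => ?_)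
        (Set.toFinite _))) (Nat.cast_nonneg _)
      exact fun h => hi ((hmem n i).1 h).2
  · rw [RootedGraphs.depthOneLaw_neighbourhoodDistribution]
    congr 1
    exact funext (hΓdeg n)
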